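/- Let $V$ be a vertex operator algebra over $\mathbb{C}$ (with finite-dimensional weight spaces and weights bounded below), let $(W_1,Y_1)$ and $(W_2,Y_2)$ be $V$-modules ($\mathbb{C}$-graded by $L(0)$-eigenvalues, i.e. $L(0)$ acts on $W_{(n)}$ as the scalar $n$, with finite-dimensional weight spaces and with $W_{(n)}=0$ when the real part of $n$ is sufficiently small), and let $z$ be a nonzero complex number. Write $\delta(x)=\sum_{n\in\mathbb{Z}}x^n$; a binomial $(a+b)^n$, $n\in\mathbb{Z}$, is always expanded in nonnegative powers of its second term $b$. For $v\in V$ let $$Y_1^*(v,x)=Y_1\bigl(e^{xL(1)}(-x^{-2})^{L(0)}v,\,x^{-1}\bigr)$$ be the opposite vertex operator on $W_1$, and let $Y_t(v,x)=\sum_{n\in\mathbb{Z}}(v\otimes t^n)x^{-n-1}$. The space $V\otimes\mathbb{C}[t,t^{-1},(z+t)^{-1}]$ acts on $(W_1\otimes W_2)^*$ by the linear map $\tau_{Q(z)}$ determined by $$\Bigl(\tau_{Q(z)}\Bigl(x_1^{-1}\delta\Bigl(\frac{z+x_0}{x_1}\Bigr)Y_t(v,x_0)\Bigr)\lambda\Bigr)(w_{1}\otimes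 w_{2}) = x_0^{-1}\delta\Bigl(\frac{x_1-z}{x_0}\Bigr)\lambda\bigl(Y_1^*(v,x_1)w_{1}\otimes w_{2}\bigr) - x_0^{-1}\delta\Bigl(\frac{z-x_1}{-x_0}\Bigr)\lambda\bigl(w_{1}\otimes Y_2(v,x_1)w_{2}\bigr)$$ for $v\in V$, $\lambda\in(W_1\otimes W_2)^*$, $w_1\in W_1$, $w_2\in W_2$; here the coefficient of $x_0^{-n-1}x_1^{-m-1}$ on the left is the action of $v\otimes t^n(z+t)^m$. Put $$Y'_{Q(z)}(v,x)=\tau_{Q(z)}(Y_t(v,x))=\sum_{n\in\mathbb{Z}}\tau_{Q(z)}(v\otimes t^n)\,x^{-n-1}.$$ Let $\lambda\in(W_1\otimes W_2)^*$ satisfy the compatibility condition, that is: (a) for every $v\in V$, $\tau_{Q(z)}(v\otimes t^n)\lambda=0$ for all sufficiently large $n$; and (b) for every $v\in V$, $$\tau_{Q(z)}\Bigl(x_1^{-1}\delta\Bigl(\frac{z+x_0}{x_1}\Bigr)Y_t(v,x_0)\Bigr)\lambda = x_1^{-1}\delta\Bigl(\frac{z+x_0}{x_1}\Bigr)Y'_{Q(z)}(v,x_0)\lambda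 .$$ Then, for all $u,v\in V$, the Jacobi identity holds on $\lambda$: $$x_0^{-1}\delta\Bigl(\frac{x_1-x_2}{x_0}\Bigr)Y'_{Q(z)}(u,x_1)Y'_{Q(z)}(v,x_2)\lambda - x_0^{-1}\delta\Bigl(\frac{x_2-x_1}{-x_0}\Bigr)Y'_{Q(z)}(v,x_2)Y'_{Q(z)}(u,x_1)\lambda = x_2^{-1}\delta\Bigl(\frac{x_1-x_0}{x_2}\Bigr)Y'_{Q(z)}\bigl(Y(u,x_0)v,x_2\bigr)\lambda ,$$ where each of the three products is well defined, every one of its coefficients being a finite sum in $(W_1\otimes W_2)^*$. -/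

import Mathlib

open scoped TensorProduct

noncomputable section

namespace QzTensor

/-! ## Formal series

A formal series `∑ F(e) x^e` in several commuting variables, with arbitrary integral exponents
(positive and negative) and coefficients in a vector space `M`, is its coefficient function
`F : Γ → M`, where `Γ` is `ℤ` (one variable), `ℤ × ℤ` (the variables `x₀, x₁`) or
`ℤ × ℤ × ℤ` (the variables `x₀, x₁, x₂`). -/

section Formal

variable {Γ M : Type*} [AddCommGroup Γ] [AddCommGroup M] [Module ℂ M]

/-- The product of the scalar formal series `d` and the formal series `F` is defined:
every coefficient of the product is a finite sum. -/
def MulDefined (d : Γ → ℂ) (F : Γ → M) : Prop :=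
  ∀ e, (Function.support fun i => d i • F (e - i)).Finite

/-- The product of the scalar formal series `d` and the formal series `F`. -/
def fmul (d : Γ → ℂ) (F : Γ → M) : Γ → M :=
  fun e => ∑ᶠ i, d i • F (e - i)

/-- The formal series `∑_n a_n x^{-n-1}` with modes `a_n`. -/
def ofModes (a : ℤ → M) : ℤ → M := fun e => a (-e - 1)

/-- A series in one variable, regarded as a series in `x₀, x₁` that involves `x₀` only. -/
def inX0 (f : ℤ → M) : ℤ × ℤ → M := fun e => if e.2 = 0 then f e.1 else 0

/-- A series in one variable, regarded as a series in `x₀, x₁` that involves `x₁` only. -/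
def inX1 (f : ℤ → M) : ℤ × ℤ → M := fun e => if e.1 = 0 then f e.2 else 0

end Formal

/-- The binomial coefficient `n (n-1) ⋯ (n-k+1) / k!` for an integer `n`; zero for `k < 0`. -/
def binom (n k : ℤ) : ℂ := if 0 ≤ k then ((Ring.choose n k.toNat : ℤ) : ℂ) else 0

/-- The coefficient of `x^i y^j w^k` in
`w⁻¹ δ((x + s y) / (t w)) = ∑_{n ∈ ℤ} t^{-n} w^{-n-1} (x + s y)^n`, where `δ(x) = ∑_{n ∈ ℤ} x^n`
and `(x + s y)^n = ∑_{j ≥ 0} binom n j s^j x^{n-j} y^j`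
is expanded in nonnegative powers of the second variable `y`. -/
def deltaCoeff (s t : ℂ) (i j k : ℤ) : ℂ :=
  if i + j + k = -1 then t ^ (k + 1) * s ^ j * binom (-k - 1) j else 0

/-- `x₀⁻¹ δ((x₁ - x₂) / x₀)`. -/
def delta12 : ℤ × ℤ × ℤ → ℂ := fun e => deltaCoeff (-1) 1 e.2.1 e.2.2 e.1

/-- `x₀⁻¹ δ((x₂ - x₁) / (-x₀))`. -/
def delta21 : ℤ × ℤ × ℤ → ℂ := fun e => deltaCoeff (-1) (-1) e.2.2 e.2.1 e.1

/-- `x₂⁻¹ δ((x₁ - x₀) / x₂)`. -/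
def delta10 : ℤ × ℤ × ℤ → ℂ := fun e => deltaCoeff (-1) 1 e.2.1 e.1 e.2.2

/-! In the next three series one variable of the delta function is replaced by the nonzero
number `z`; its exponent is determined by the other two, since the total degree is `-1`. -/

/-- `x₀⁻¹ δ((x₁ - z) / x₀)`, expanded in nonnegative powers of `z`. -/
def deltaX1Z (z : ℂ) : ℤ × ℤ → ℂ := fun e =>
  deltaCoeff (-1) 1 e.2 (-1 - e.1 - e.2) e.1 * z ^ (-1 - e.1 - e.2)

/-- `x₀⁻¹ δ((z - x₁) / (-x₀))`, expanded in nonnegative powers of `x₁`. -/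
def deltaZX1 (z : ℂ) : ℤ × ℤ → ℂ := fun e =>
  deltaCoeff (-1) (-1) (-1 - e.1 - e.2) e.2 e.1 * z ^ (-1 - e.1 - e.2)

/-- `x₁⁻¹ δ((z + x₀) / x₁)`, expanded in nonnegative powers of `x₀`. -/
def deltaZX0 (z : ℂ) : ℤ × ℤ → ℂ := fun e =>
  deltaCoeff 1 1 (-1 - e.1 - e.2) e.1 e.2 * z ^ (-1 - e.1 - e.2)

/-! ## The Jacobi identity -/

section Jacobi

variable {V M : Type*} [AddCommGroup V] [Module ℂ V] [AddCommGroup M] [Module ℂ M]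

/-- `A(x₁) B(x₂) m` for `A(x) = ∑ A_n x^{-n-1}` and `B(x) = ∑ B_n x^{-n-1}`. -/
def prod12 (A B : ℤ → Module.End ℂ M) (m : M) : ℤ × ℤ × ℤ → M := fun e =>
  if e.1 = 0 then A (-e.2.1 - 1) (B (-e.2.2 - 1) m) else 0

/-- `B(x₂) A(x₁) m` for `A(x) = ∑ A_n x^{-n-1}` and `B(x) = ∑ B_n x^{-n-1}`. -/
def prod21 (A B : ℤ → Module.End ℂ M) (m : M) : ℤ × ℤ × ℤ → M := fun e =>
  if e.1 = 0 then B (-e.2.2 - 1) (A (-e.2.1 - 1) m) else 0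

/-- `Y_M(Y(u, x₀) v, x₂) m`. -/
def iterate02 (Y : V → ℤ → Module.End ℂ V) (YM : V → ℤ → Module.End ℂ M) (u v : V) (m : M) :
    ℤ × ℤ × ℤ → M := fun e =>
  if e.2.1 = 0 then YM (Y u (-e.1 - 1) v) (-e.2.2 - 1) m else 0

/-- The Jacobi identity for `u, v` acting on the vector `m`: the three products are defined and
`x₀⁻¹ δ((x₁ - x₂)/x₀) Y_M(u, x₁) Y_M(v, x₂) m - x₀⁻¹ δ((x₂ - x₁)/(-x₀)) Y_M(v, x₂) Y_M(u, x₁) m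
= x₂⁻¹ δ((x₁ - x₀)/x₂) Y_M(Y(u, x₀) v, x₂) m`. -/
def JacobiOn (Y : V → ℤ → Module.End ℂ V) (YM : V → ℤ → Module.End ℂ M) (u v : V) (m : M) :
    Prop :=
  MulDefined delta12 (prod12 (YM u) (YM v) m) ∧
  MulDefined delta21 (prod21 (YM u) (YM v) m) ∧
  MulDefined delta10 (iterate02 Y YM u v m) ∧
  fmul delta12 (prod12 (YM u) (YM v) m) - fmul delta21 (prod21 (YM u) (YM v) m) =
    fmul delta10 (iterate02 Y YM u v m)

end Jacobi

/-! ## Vertex operator algebras and their modules -/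

/-- A vertex operator algebra structure on a complex vector space `V`.
`Y v n` is the mode `v_n` of `Y(v, x) = ∑ v_n x^{-n-1}`; the Virasoro operators are
`L(n) = ω_{n+1}`. -/
structure VertexOperatorAlgebra (V : Type*) [AddCommGroup V] [Module ℂ V] where
  /-- the weight spaces -/
  grade : ℤ → Submodule ℂ V
  grade_internal : DirectSum.IsInternal grade
  grade_finite : ∀ n, FiniteDimensional ℂ (grade n)
  grade_bounded : ∃ N : ℤ, ∀ n < N, grade n = ⊥
  /-- the vertex operators -/
  Y : V →ₗ[ℂ] (ℤ → Module.End ℂ V)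
  /-- the vacuum vector -/
  vac : V
  vac_mem : vac ∈ grade 0
  /-- the Virasoro element -/
  omega : V
  omega_mem : omega ∈ grade 2
  /-- the central charge (rank) -/
  rank : ℂ
  truncation : ∀ u v : V, ∃ N : ℤ, ∀ n ≥ N, Y u n v = 0
  vacuum : ∀ n : ℤ, Y vac n = if n = -1 then 1 else 0
  creation : ∀ v : V, Y v (-1) vac = v ∧ ∀ n ≥ 0, Y v n vac = 0
  jacobi : ∀ u v w : V, JacobiOn (fun v => Y v) (fun v => Y v) u v w
  virasoro : ∀ m n : ℤ, ⁅Y omega (m + 1), Y omega (n + 1)⁆ =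
    ((m - n : ℤ) : ℂ) • Y omega (m + n + 1) +
      (if m + n = 0 then ((m : ℂ) ^ 3 - m) / 12 * rank else 0) • (1 : Module.End ℂ V)
  L0_grade : ∀ (n : ℤ), ∀ v ∈ grade n, Y omega 1 v = (n : ℂ) • v
  /-- `d/dx Y(v, x) = Y(L(-1) v, x)` -/
  derivative : ∀ (v : V) (n : ℤ), Y (Y omega 0 v) n = (-n : ℂ) • Y v (n - 1)

open Classical in
/-- A module structure on the complex vector space `W` for the vertex operator algebra `A`. -/
structure VOAModule {V : Type*} [AddCommGroup V] [Module ℂ V] (A : VertexOperatorAlgebra V)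
    (W : Type*) [AddCommGroup W] [Module ℂ W] where
  /-- the weight spaces -/
  grade : ℂ → Submodule ℂ W
  grade_internal : DirectSum.IsInternal grade
  grade_finite : ∀ n, FiniteDimensional ℂ (grade n)
  grade_bounded : ∃ N : ℝ, ∀ n : ℂ, n.re < N → grade n = ⊥
  /-- the vertex operators -/
  Y : V →ₗ[ℂ] (ℤ → Module.End ℂ W)
  truncation : ∀ (v : V) (w : W), ∃ N : ℤ, ∀ n ≥ N, Y v n w = 0
  vacuum : ∀ n : ℤ, Y A.vac n = if n = -1 then 1 else 0
  jacobi : ∀ (u v : V) (w : W), JacobiOn (fun v => A.Y v) (fun v => Y v) u v w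
  virasoro : ∀ m n : ℤ, ⁅Y A.omega (m + 1), Y A.omega (n + 1)⁆ =
    ((m - n : ℤ) : ℂ) • Y A.omega (m + n + 1) +
      (if m + n = 0 then ((m : ℂ) ^ 3 - m) / 12 * A.rank else 0) • (1 : Module.End ℂ W)
  L0_grade : ∀ (n : ℂ), ∀ w ∈ grade n, Y A.omega 1 w = n • w
  /-- `d/dx Y(v, x) = Y(L(-1) v, x)` -/
  derivative : ∀ (v : V) (n : ℤ), Y (A.Y A.omega 0 v) n = (-n : ℂ) • Y v (n - 1)

/-! ## The opposite vertex operators -/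

namespace VertexOperatorAlgebra

variable {V : Type*} [AddCommGroup V] [Module ℂ V] (A : VertexOperatorAlgebra V)

/-- `V` is the direct sum of its weight spaces. -/
def decomp : DirectSum ℤ (fun n => A.grade n) ≃ₗ[ℂ] V :=
  LinearEquiv.ofBijective (DirectSum.coeLinearMap A.grade)
    (show Function.Bijective (DirectSum.coeLinearMap A.grade) from A.grade_internal)

/-- The projection of `V` onto the weight space of weight `h`. -/
def proj (h : ℤ) : V →ₗ[ℂ] V :=
  (A.grade h).subtype ∘ₗ DirectSum.component ℂ ℤ (fun n => A.grade n) h ∘ₗ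
    A.decomp.symm.toLinearMap

/-- `L(1) = ω_2`. -/
def L1 : Module.End ℂ V := A.Y A.omega 2

theorem proj_mem (h : ℤ) (v : V) : A.proj h v ∈ A.grade h := by
  simp [proj]

theorem proj_finite (v : V) : {h | A.proj h v ≠ 0}.Finite := by
  classical
  set x := A.decomp.symm v
    with hx
  refine (x.support.finite_toSet).subset ?_
  intro h hh
  simp only [Finset.mem_coe, DFinsupp.mem_support_toFun]
  intro h0
  apply hh
  change ((x h : A.grade h) : V) = 0
  rw [h0]; rfl

theorem proj_of_mem {n : ℤ} {v : V} (hv : v ∈ A.grade n) (h : ℤ) :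
    A.proj h v = if h = n then v else 0 := by
  classical
  have h1 : A.decomp.symm v =
      DirectSum.lof ℂ ℤ (fun n => A.grade n) n ⟨v, hv⟩ := by
    rw [LinearEquiv.symm_apply_eq]
    exact (DirectSum.coeLinearMap_lof A.grade n ⟨v, hv⟩).symm
  simp only [proj, LinearMap.comp_apply, LinearEquiv.coe_coe, h1]
  split_ifs with hn
  · subst hn
    simp [DirectSum.component.lof_self]
  · rw [DirectSum.component.of]
    rw [dif_neg (fun h => hn h.symm)]
    simp

theorem eq_sum_proj (v : V) : ∃ s : Finset ℤ, v = ∑ n ∈ s, A.proj n v := by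
  classical
  set x := A.decomp.symm v
    with hx
  refine ⟨x.support, ?_⟩
  have h1 : v = DirectSum.coeLinearMap A.grade x := by
    exact (A.decomp.apply_symm_apply v).symm
  conv_lhs => rw [h1, DirectSum.coeLinearMap_eq_dfinsuppSum]
  rfl

theorem proj_L0 (k : ℤ) (v : V) : A.proj k (A.Y A.omega 1 v) = (k : ℂ) • A.proj k v := by
  obtain ⟨s, hs⟩ := A.eq_sum_proj v
  rw [hs]
  simp only [map_sum, Finset.smul_sum]
  refine Finset.sum_congr rfl fun n _ => ?_
  have hm := A.proj_mem n v
  rw [A.L0_grade n _ hm, map_smul, A.proj_of_mem hm]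
  split_ifs with h
  · rw [h]
  · simp

theorem eq_zero_of_L0 {k : ℤ} (hk : A.grade k = ⊥) {v : V}
    (hv : A.Y A.omega 1 v = (k : ℂ) • v) : v = 0 := by
  obtain ⟨s, hs⟩ := A.eq_sum_proj v
  rw [hs]
  refine Finset.sum_eq_zero fun n _ => ?_
  by_cases hn : n = k
  · have := A.proj_mem n v
    rw [hn, hk, Submodule.mem_bot] at this
    rw [hn, this]
  · have h1 := A.proj_L0 n v
    rw [hv, map_smul, ← sub_eq_zero, ← sub_smul, smul_eq_zero] at h1
    rcases h1 with h1 | h1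
    · exact absurd (by exact_mod_cast (sub_eq_zero.mp h1).symm) hn
    · exact h1

theorem L0_L1_pow {h : ℤ} {v : V} (hv : v ∈ A.grade h) (j : ℕ) :
    A.Y A.omega 1 ((A.L1 ^ j) v) = ((h - j : ℤ) : ℂ) • (A.L1 ^ j) v := by
  induction j with
  | zero => simpa using A.L0_grade h v hv
  | succ j ih =>
    have hc := congrArg (fun f => f ((A.L1 ^ j) v)) (A.virasoro 0 1)
    simp only [Ring.lie_def] at hc
    norm_num at hc
    rw [ih] at hc
    rw [pow_succ']
    change A.Y A.omega 1 (A.Y A.omega 2 ((A.L1 ^ j) v)) = _ • A.Y A.omega 2 ((A.L1 ^ j) v)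
    rw [sub_eq_iff_eq_add] at hc
    rw [hc, map_smul]
    push_cast
    module

theorem L1_pow_finite (v : V) : {p : ℤ × ℕ | (A.L1 ^ p.2) (A.proj p.1 v) ≠ 0}.Finite := by
  obtain ⟨N, hN⟩ := A.grade_bounded
  have hf := A.proj_finite v
  refine Set.Finite.subset
    (hf.biUnion (t := fun h => (fun j : ℕ => (h, j)) '' Set.Iic (h - N).toNat)
      fun h _ => (Set.finite_Iic _).image _) ?_
  rintro ⟨h, j⟩ hp
  simp only [Set.mem_ofPred_eq] at hp
  simp only [Set.mem_iUnion]
  refine ⟨h, ?_, j, ?_, rfl⟩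
  · intro h0
    exact hp (by rw [h0, map_zero])
  · by_contra hj
    simp only [Set.mem_Iic, not_le] at hj
    exact hp (A.eq_zero_of_L0 (hN (h - j) (by omega)) (A.L0_L1_pow (A.proj_mem h v) j))

end VertexOperatorAlgebra

namespace VOAModule

variable {V : Type*} [AddCommGroup V] [Module ℂ V] {A : VertexOperatorAlgebra V}
  {W : Type*} [AddCommGroup W] [Module ℂ W] (M : VOAModule A W)

/-- The mode `v*_p` of the opposite vertex operator
`Y*(v, x) = Y(e^{x L(1)} (-x^{-2})^{L(0)} v, x^{-1}) = ∑_p v*_p x^{-p-1}`. With `v_h` the component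
of `v` of weight `h`,
`e^{x L(1)} (-x^{-2})^{L(0)} v = ∑_{h, j} (-1)^h / j! x^{j-2h} L(1)^j v_h`,
a finite sum, and the coefficient of `x^{-p-1}` in `x^{j-2h} Y(u, x^{-1})` is `u_{2h-j-p-2}`. -/
def Ystar (v : V) (p : ℤ) : Module.End ℂ W :=
  ∑ᶠ q : ℤ × ℕ, ((-1 : ℂ) ^ q.1 / (q.2.factorial : ℂ)) •
    M.Y ((A.L1 ^ q.2) (A.proj q.1 v)) (2 * q.1 - q.2 - p - 2)

theorem Ystar_truncation (v : V) (w : W) : ∃ N : ℤ, ∀ p ≤ N, M.Ystar v p w = 0 := by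
  have hf := A.L1_pow_finite v
  choose N hN using fun u : V => M.truncation u w
  obtain ⟨B, hB⟩ : ∃ B : ℤ, ∀ q ∈ hf.toFinset,
      B ≤ 2 * q.1 - q.2 - 2 - N ((A.L1 ^ q.2) (A.proj q.1 v)) := by
    obtain ⟨B, hB⟩ := (hf.toFinset.image fun q : ℤ × ℕ =>
      2 * q.1 - q.2 - 2 - N ((A.L1 ^ q.2) (A.proj q.1 v))).bddBelow
    exact ⟨B, fun q hq => hB (Finset.mem_coe.mpr (Finset.mem_image_of_mem _ hq))⟩
  refine ⟨B, fun p hp => ?_⟩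
  rw [Ystar, finsum_eq_sum_of_support_subset (s := hf.toFinset)]
  · rw [LinearMap.sum_apply]
    refine Finset.sum_eq_zero fun q hq => ?_
    have := hB q hq
    rw [LinearMap.smul_apply, hN _ _ (by omega), smul_zero]
  · intro q hq
    simp only [Set.Finite.coe_toFinset, Set.mem_ofPred_eq]
    intro h0
    apply hq
    simp [h0]

end VOAModule

/-! ## The action of `V ⊗ ℂ[t, t⁻¹, (z + t)⁻¹]` on the dual of `W₁ ⊗ W₂` -/

section Action

theorem mulDefined_deltaX1Z {M : Type*} [AddCommGroup M] [Module ℂ M] (z : ℂ) (f : ℤ → M)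
    (hf : ∃ N : ℤ, ∀ n ≤ N, f n = 0) : MulDefined (deltaX1Z z) (inX1 (ofModes f)) := by
  obtain ⟨N, hN⟩ := hf
  rintro ⟨a, b⟩
  refine ((Set.finite_Icc (b + N + 1) (-1 - a)).image fun j => (a, j)).subset ?_
  rintro ⟨i, j⟩ hij
  simp only [Function.mem_support, ne_eq, smul_eq_zero, not_or] at hij
  obtain ⟨h1, h2⟩ := hij
  simp only [inX1, ofModes, Prod.mk_sub_mk, ite_eq_right_iff, not_forall] at h2
  obtain ⟨h2, h3⟩ := h2
  have hia : i = a := by omega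
  subst hia
  refine ⟨j, ⟨?_, ?_⟩, rfl⟩
  · by_contra hc
    exact h3 (hN _ (by omega))
  · by_contra hc
    apply h1
    have h0 : ¬ 0 ≤ -1 - i - j := by omega
    simp only [deltaX1Z, deltaCoeff, binom, if_neg h0, mul_zero, ite_self, zero_mul]

theorem mulDefined_deltaZX1 {M : Type*} [AddCommGroup M] [Module ℂ M] (z : ℂ) (f : ℤ → M)
    (hf : ∃ N : ℤ, ∀ n ≥ N, f n = 0) : MulDefined (deltaZX1 z) (inX1 (ofModes f)) := by
  obtain ⟨N, hN⟩ := hf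
  rintro ⟨a, b⟩
  refine ((Set.finite_Icc 0 (b + N)).image fun j => (a, j)).subset ?_
  rintro ⟨i, j⟩ hij
  simp only [Function.mem_support, ne_eq, smul_eq_zero, not_or] at hij
  obtain ⟨h1, h2⟩ := hij
  simp only [inX1, ofModes, Prod.mk_sub_mk, ite_eq_right_iff, not_forall] at h2
  obtain ⟨h2, h3⟩ := h2
  have hia : i = a := by omega
  subst hia
  refine ⟨j, ⟨?_, ?_⟩, rfl⟩
  · by_contra hc
    apply h1
    simp [deltaZX1, deltaCoeff, binom, hc]
  · by_contra hc
    exact h3 (hN _ (by omega))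

theorem fmul_ofModes_add {M : Type*} [AddCommGroup M] [Module ℂ M] {d : ℤ × ℤ → ℂ} {f g : ℤ → M}
    (hf : MulDefined d (inX1 (ofModes f))) (hg : MulDefined d (inX1 (ofModes g))) (e : ℤ × ℤ) :
    fmul d (inX1 (ofModes fun n => f n + g n)) e =
      fmul d (inX1 (ofModes f)) e + fmul d (inX1 (ofModes g)) e := by
  rw [fmul, fmul, fmul, ← finsum_add_distrib (hf e) (hg e)]
  refine finsum_congr fun i => ?_
  rw [← smul_add]
  simp only [inX1, ofModes]
  split_ifs <;> simp

theorem fmul_ofModes_smul {M : Type*} [AddCommGroup M] [Module ℂ M] {d : ℤ × ℤ → ℂ} {f : ℤ → M}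
    (c : ℂ) (e : ℤ × ℤ) :
    fmul d (inX1 (ofModes fun n => c • f n)) e = c • fmul d (inX1 (ofModes f)) e := by
  rw [fmul, fmul, smul_finsum]
  refine finsum_congr fun i => ?_
  rw [smul_comm]
  simp only [inX1, ofModes]
  split_ifs <;> simp

variable {V : Type*} [AddCommGroup V] [Module ℂ V] {A : VertexOperatorAlgebra V}
  {W₁ : Type*} [AddCommGroup W₁] [Module ℂ W₁] {W₂ : Type*} [AddCommGroup W₂] [Module ℂ W₂]

/-- The coefficients (in `x₀, x₁`) of `x₀⁻¹ δ((x₁ - z)/x₀) Y₁*(v, x₁)`, as operators on `W₁`. -/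
def starPart (M₁ : VOAModule A W₁) (z : ℂ) (v : V) (e : ℤ × ℤ) : Module.End ℂ W₁ where
  toFun w := fmul (deltaX1Z z) (inX1 (ofModes fun n => M₁.Ystar v n w)) e
  map_add' w w' := by
    simp only [map_add]
    exact fmul_ofModes_add (mulDefined_deltaX1Z z _ (M₁.Ystar_truncation v w))
      (mulDefined_deltaX1Z z _ (M₁.Ystar_truncation v w')) e
  map_smul' c w := by
    simp only [map_smul]
    exact fmul_ofModes_smul c e

/-- The coefficients (in `x₀, x₁`) of `x₀⁻¹ δ((z - x₁)/(-x₀)) Y₂(v, x₁)`, as operators on `W₂`. -/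
def plusPart (M₂ : VOAModule A W₂) (z : ℂ) (v : V) (e : ℤ × ℤ) : Module.End ℂ W₂ where
  toFun w := fmul (deltaZX1 z) (inX1 (ofModes fun n => M₂.Y v n w)) e
  map_add' w w' := by
    simp only [map_add]
    exact fmul_ofModes_add (mulDefined_deltaZX1 z _ (M₂.truncation v w))
      (mulDefined_deltaZX1 z _ (M₂.truncation v w')) e
  map_smul' c w := by
    simp only [map_smul]
    exact fmul_ofModes_smul c e

/-- The formal series in `x₀, x₁` of operators on the dual of `W₁ ⊗ W₂`
`τ_{Q(z)}(x₁⁻¹ δ((z + x₀)/x₁) Y_t(v, x₀))`, where `Y_t(v, x) = ∑ (v ⊗ t^n) x^{-n-1}`, given by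
`(τ_{Q(z)}(x₁⁻¹ δ((z + x₀)/x₁) Y_t(v, x₀)) λ)(w₁ ⊗ w₂)
  = x₀⁻¹ δ((x₁ - z)/x₀) λ(Y₁*(v, x₁) w₁ ⊗ w₂) - x₀⁻¹ δ((z - x₁)/(-x₀)) λ(w₁ ⊗ Y₂(v, x₁) w₂)`.
The coefficient of `x₀^{-n-1} x₁^{-m-1}` is the action of `v ⊗ t^n (z + t)^m`; these elements
span `V ⊗ ℂ[t, t⁻¹, (z + t)⁻¹]`. -/
def tauQ (M₁ : VOAModule A W₁) (M₂ : VOAModule A W₂) (z : ℂ) (v : V) (e : ℤ × ℤ) :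
    Module.End ℂ (Module.Dual ℂ (W₁ ⊗[ℂ] W₂)) :=
  ((starPart M₁ z v e).rTensor W₂ - (plusPart M₂ z v e).lTensor W₁).dualMap

/-- The modes of `Y'_{Q(z)}(v, x₀) = ∑_n τ_{Q(z)}(v ⊗ t^n) x₀^{-n-1}`: the mode `n` is the
coefficient of `x₀^{-n-1} x₁^{-1}` in `τ_{Q(z)}(x₁⁻¹ δ((z + x₀)/x₁) Y_t(v, x₀))`. -/
def YQ (M₁ : VOAModule A W₁) (M₂ : VOAModule A W₂) (z : ℂ) (v : V) (n : ℤ) :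
    Module.End ℂ (Module.Dual ℂ (W₁ ⊗[ℂ] W₂)) :=
  tauQ M₁ M₂ z v (-n - 1, -1)

/-- The compatibility condition on `lam` in the dual of `W₁ ⊗ W₂`: lower truncation, and
`τ_{Q(z)}(x₁⁻¹ δ((z + x₀)/x₁) Y_t(v, x₀)) lam = x₁⁻¹ δ((z + x₀)/x₁) Y'_{Q(z)}(v, x₀) lam`
for all `v`. The product on the right is defined by the lower truncation. -/
def Compatible (M₁ : VOAModule A W₁) (M₂ : VOAModule A W₂) (z : ℂ)
    (lam : Module.Dual ℂ (W₁ ⊗[ℂ] W₂)) : Prop :=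
  (∀ v : V, ∃ N : ℤ, ∀ n ≥ N, YQ M₁ M₂ z v n lam = 0) ∧
  ∀ v : V, (fun e => tauQ M₁ M₂ z v e lam) =
    fmul (deltaZX0 z) (inX0 (ofModes fun n => YQ M₁ M₂ z v n lam))

end Action

end QzTensor

end

noncomputable section

namespace QzTensor

/-! ## Binomial expansions -/

/-! Write `t = x - z`. On `W₁` the element `v ⊗ t^n (z + t)^k` acts as the residue of `(x - z)^n x^k
Y₁*(v, x)`, expanded in nonnegative powers of `z`; on `W₂` as the residue of `(x - z)^n x^k Y₂(v,
x)`, expanded in nonnegative powers of `x`. The action on functionals is the difference of the two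
transposes (`tauMode_apply_tmul`), and `Y'_{Q(z)}` consists of the modes with `k = 0`. Every Jacobi
identity is handled as Borcherds' identity, one scalar equation for each triple of exponents,
written with the binomial sums `binExp`.

Commutators. `Y₂` satisfies the Jacobi identity and `Y₁*` satisfies it with the products reversed
(`VOAModule.oppositeJacobiOn`), a reversal that transposition undoes. Both identities survive
multiplication by powers of `x₁ - z` and `x₂ - z` (`borcherds_twist`). For any functional, multiply
the product of two actions by `(x₁ - x₂)^l`, expanded according to the order in which the operators
act (`tauProd`). In the difference of the two orders the mixed terms, one operator on each tensor
factor, cancel, and the remaining terms give the iterate (`tauProd_sub_tauProd`).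

Compatibility. The Jacobi identity for `Y'_{Q(z)}` instead expands `x₁ - x₂ = t₁ - t₂` in powers of
the second `t`. On a compatible functional the two expansions agree (`Compatible.tauProd_eq`): they
obey the same recursion in `l`, coincide at `l = 0`, and both vanish once the exponent `n` of `t₂`
is large. Uniformity of that bound in the other exponents is what condition (b) supplies
(`Compatible.tauMode_truncation`). -/

theorem finsum_eq_sum_range {M : Type*} [AddCommGroup M] {f : ℕ → M} {N : ℕ} (hf : ∀ i, N ≤ i → f i = 0) :
    ∑ᶠ i, f i = ∑ i ∈ Finset.range N, f i := by
  refine finsum_eq_sum_of_support_subset _ fun i hi => ?_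
  by_contra h
  exact hi (hf i (by simpa using h))

/-- The condition under which the sums `binExp c l P k h` are finite. -/
def Trunc {M : Type*} [AddCommGroup M] (P : ℤ → ℤ → M) : Prop := ∀ k h, ∃ N : ℕ, ∀ i : ℕ, N ≤ i → P (k - i) (h + i) = 0

theorem Trunc.shift {M : Type*} [AddCommGroup M] {P : ℤ → ℤ → M} (hP : Trunc P) (a b : ℤ) :
    Trunc fun k h => P (k + a) (h + b) := by
  intro k h
  obtain ⟨N, hN⟩ := hP (k + a) (h + b)
  refine ⟨N, fun i hi => ?_⟩
  rw [← hN i hi]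
  change P (k - i + a) (h + i + b) = _
  congr 1 <;> ring

theorem Trunc.add {M : Type*} [AddCommGroup M] {P Q : ℤ → ℤ → M} (hP : Trunc P) (hQ : Trunc Q) :
    Trunc fun k h => P k h + Q k h := by
  intro k h
  obtain ⟨N, hN⟩ := hP k h
  obtain ⟨N', hN'⟩ := hQ k h
  exact ⟨max N N', fun i hi => by
    simp only [hN i (le_of_max_le_left hi), hN' i (le_of_max_le_right hi), add_zero]⟩

theorem Trunc.sum {ι : Type*} (s : Finset ι) {M : Type*} [AddCommGroup M] {P : ι → ℤ → ℤ → M} (hP : ∀ j ∈ s, Trunc (P j)) :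
    Trunc fun k h => ∑ j ∈ s, P j k h := by
  classical
  induction s using Finset.induction_on with
  | empty => exact fun k h => ⟨0, fun i _ => by simp⟩
  | insert a s ha ih =>
    simp only [Finset.sum_insert ha]
    exact (hP a (by simp)).add (ih fun j hj => hP j (by simp [hj]))

section BinExp

variable {M N : Type*} [AddCommGroup M] [Module ℂ M] [AddCommGroup N] [Module ℂ N]

/-- The binomial coefficient with integral upper index, as a complex number. -/
def bc (l : ℤ) (i : ℕ) : ℂ := ((Ring.choose l i : ℤ) : ℂ)

@[simp] theorem bc_zero_right (l : ℤ) : bc l 0 = 1 := by simp [bc]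

theorem bc_zero_succ (i : ℕ) : bc 0 (i + 1) = 0 := by simp [bc]

theorem bc_succ_succ (l : ℤ) (i : ℕ) : bc (l + 1) (i + 1) = bc l i + bc l (i + 1) := by
  simp [bc, Ring.choose_succ_succ]

theorem succ_mul_bc (l : ℤ) (i : ℕ) : ((i : ℂ) + 1) * bc l (i + 1) = ((l : ℂ) - i) * bc l i := by
  have h := Ring.choose_smul_choose l (Nat.le_succ i)
  simp only [Nat.succ_eq_add_one, Nat.choose_succ_self_right, Nat.add_sub_cancel_left,
    Ring.choose_one_right, nsmul_eq_mul] at h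
  have h' := congrArg (fun x : ℤ => (x : ℂ)) h
  push_cast at h'
  rw [bc, bc, h', mul_comm]

theorem bc_neg (l : ℤ) (i : ℕ) : bc (-l) i = (-1) ^ i * bc (l + i - 1) i := by
  rw [bc, bc, Ring.choose_neg, Units.smul_def, Int.negOnePow_def, zpow_natCast]
  push_cast [smul_eq_mul]
  rfl

theorem bc_add (r s : ℤ) (k : ℕ) :
    bc (r + s) k = ∑ ij ∈ Finset.HasAntidiagonal.antidiagonal k, bc r ij.1 * bc s ij.2 := by
  simp only [bc]
  rw [Ring.add_choose_eq k (Commute.all r s)]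
  push_cast
  rfl

/-- Compare coefficients of `y^n` in `(1 + y)^P (1 - y / (1 + y))^k = (1 + y)^(P - k)`. The proof
negates the upper indices, which turns the identity into Vandermonde's. -/
theorem sum_antidiagonal_bc_mul_bc (P k : ℤ) (n : ℕ) :
    ∑ ij ∈ Finset.HasAntidiagonal.antidiagonal n, (-1) ^ ij.1 * bc k ij.1 * bc (P - ij.1) ij.2 =
      bc (P - k) n := by
  have h : bc (P - k) n = (-1) ^ n * bc (k + (n - P - 1)) n := by
    rw [show P - k = -(k - P) by ring, bc_neg]
    congr 2
    ring
  rw [h, bc_add, Finset.mul_sum]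
  refine Finset.sum_congr rfl fun ij hij => ?_
  have h1 : (ij.1 : ℤ) + ij.2 = n := by exact_mod_cast Finset.HasAntidiagonal.mem_antidiagonal.1 hij
  have h2 : bc (P - ij.1) ij.2 = (-1) ^ ij.2 * bc (n - P - 1) ij.2 := by
    rw [show P - ij.1 = -(ij.1 - P) by ring, bc_neg]
    congr 2
    omega
  rw [h2, ← Finset.HasAntidiagonal.mem_antidiagonal.1 hij, pow_add]
  ring

/-- The value on `x^k y^h (x + c y)^l`, expanded in nonnegative powers of `y`, of the functional
that takes the value `P k h` on `x^k y^h`. -/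
def binExp (c : ℂ) (l : ℤ) (P : ℤ → ℤ → M) (k h : ℤ) : M :=
  ∑ᶠ i : ℕ, (c ^ i * bc l i) • P (k + l - i) (h + i)

theorem binExp_eq_sum {c : ℂ} {l : ℤ} {P : ℤ → ℤ → M} {k h : ℤ} {N : ℕ}
    (hN : ∀ i : ℕ, N ≤ i → P (k + l - i) (h + i) = 0) :
    binExp c l P k h = ∑ i ∈ Finset.range N, (c ^ i * bc l i) • P (k + l - i) (h + i) :=
  finsum_eq_sum_range fun i hi => by rw [hN i hi, smul_zero]

theorem binExp_eq_zero {c : ℂ} {l : ℤ} {P : ℤ → ℤ → M} {k h : ℤ}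
    (hP : ∀ i : ℕ, P (k + l - i) (h + i) = 0) : binExp c l P k h = 0 := by
  rw [binExp_eq_sum (N := 0) fun i _ => hP i, Finset.sum_range_zero]

theorem binExp_congr {c : ℂ} {l : ℤ} {P Q : ℤ → ℤ → M} {k h k' h' : ℤ}
    (hP : ∀ i : ℕ, P (k + l - i) (h + i) = Q (k' + l - i) (h' + i)) :
    binExp c l P k h = binExp c l Q k' h' :=
  finsum_congr fun i => by rw [hP i]

@[simp] theorem binExp_zero (c : ℂ) (P : ℤ → ℤ → M) (k h : ℤ) : binExp c 0 P k h = P k h := by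
  rw [binExp, finsum_eq_sum_range (N := 1)]
  · simp
  · rintro (_ | i) hi
    · omega
    · rw [bc_zero_succ, mul_zero, zero_smul]

theorem Trunc.finite {P : ℤ → ℤ → M} (hP : Trunc P) (c : ℂ) (l k h : ℤ) :
    (Function.support fun i : ℕ => (c ^ i * bc l i) • P (k + l - i) (h + i)).Finite := by
  obtain ⟨N, hN⟩ := hP (k + l) h
  refine (Set.finite_Iio N).subset fun i hi => ?_
  by_contra hc
  exact hi (by simp only [hN i (by simpa using hc), smul_zero])

theorem binExp_add (c : ℂ) (l : ℤ) {P Q : ℤ → ℤ → M} (hP : Trunc P) (hQ : Trunc Q) (k h : ℤ) :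
    binExp c l (fun k h => P k h + Q k h) k h = binExp c l P k h + binExp c l Q k h := by
  rw [binExp, binExp, binExp, ← finsum_add_distrib (hP.finite c l k h) (hQ.finite c l k h)]
  simp only [smul_add]

theorem binExp_smul (c : ℂ) (l : ℤ) (a : ℂ) (P : ℤ → ℤ → M) (k h : ℤ) :
    binExp c l (fun k h => a • P k h) k h = a • binExp c l P k h := by
  rw [binExp, binExp, smul_finsum]
  simp only [smul_comm a]

theorem Trunc.smul {P : ℤ → ℤ → M} (hP : Trunc P) (a : ℂ) : Trunc fun k h => a • P k h := by
  intro k h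
  obtain ⟨N, hN⟩ := hP k h
  exact ⟨N, fun i hi => by simp only [hN i hi, smul_zero]⟩

theorem Trunc.map {P : ℤ → ℤ → M} (hP : Trunc P) (f : M →ₗ[ℂ] N) : Trunc fun k h => f (P k h) := by
  intro k h
  obtain ⟨N, hN⟩ := hP k h
  exact ⟨N, fun i hi => by simp only [hN i hi, map_zero]⟩

theorem binExp_sum (c : ℂ) (l : ℤ) {ι : Type*} (s : Finset ι) {P : ι → ℤ → ℤ → M}
    (hP : ∀ j ∈ s, Trunc (P j)) (k h : ℤ) :
    binExp c l (fun k h => ∑ j ∈ s, P j k h) k h = ∑ j ∈ s, binExp c l (P j) k h := by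
  classical
  induction s using Finset.induction_on with
  | empty => simpa using binExp_eq_zero fun i => rfl
  | insert a s ha ih =>
    simp only [Finset.sum_insert ha]
    rw [binExp_add c l (hP a (by simp)) (Trunc.sum s fun j hj => hP j (by simp [hj])),
      ih fun j hj => hP j (by simp [hj])]

theorem binExp_sub (c : ℂ) (l : ℤ) {P Q : ℤ → ℤ → M} (hP : Trunc P) (hQ : Trunc Q) (k h : ℤ) :
    binExp c l (fun k h => P k h - Q k h) k h = binExp c l P k h - binExp c l Q k h := by
  have := binExp_add c l hP (hQ.smul (-1)) k h
  rw [binExp_smul] at this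
  simpa [sub_eq_add_neg] using this

theorem map_binExp (f : M →ₗ[ℂ] N) (c : ℂ) (l : ℤ) {P : ℤ → ℤ → M} (hP : Trunc P) (k h : ℤ) :
    f (binExp c l P k h) = binExp c l (fun k h => f (P k h)) k h := by
  rw [binExp, binExp, ← LinearMap.toAddMonoidHom_coe, AddMonoidHom.map_finsum _ (hP.finite c l k h)]
  simp

theorem binExp_shift (c : ℂ) (l : ℤ) (P : ℤ → ℤ → M) (a b k h : ℤ) :
    binExp c l (fun k h => P (k + a) (h + b)) k h = binExp c l P (k + a) (h + b) := by
  refine binExp_congr fun i => ?_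
  congr 1 <;> ring

/-- Multiplication by one more factor `x + c y`. -/
theorem binExp_succ (c : ℂ) (l : ℤ) {P : ℤ → ℤ → M} (hP : Trunc P) (k h : ℤ) :
    binExp c (l + 1) P k h = binExp c l P (k + 1) h + c • binExp c l P k (h + 1) := by
  obtain ⟨N, hN⟩ := hP (k + l + 1) h
  have e1 : ∀ i : ℕ, N + 1 ≤ i → P (k + (l + 1) - i) (h + i) = 0 := fun i hi => by
    rw [← hN i (by omega)]; congr 1; ring
  have e2 : ∀ i : ℕ, N + 1 ≤ i → P (k + 1 + l - i) (h + i) = 0 := fun i hi => by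
    rw [← hN i (by omega)]; congr 1; ring
  have e3 : ∀ i : ℕ, N ≤ i → P (k + l - i) (h + 1 + i) = 0 := fun i hi => by
    rw [← hN (i + 1) (by omega)]; congr 1 <;> push_cast <;> ring
  rw [binExp_eq_sum e1, binExp_eq_sum e2, binExp_eq_sum e3, Finset.sum_range_succ',
    Finset.sum_range_succ', Finset.smul_sum, add_right_comm, ← Finset.sum_add_distrib]
  congr 1
  · refine Finset.sum_congr rfl fun i _ => ?_
    rw [bc_succ_succ, show k + (l + 1) - ((i + 1 : ℕ) : ℤ) = k + l - i by push_cast; ring,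
      show k + 1 + l - ((i + 1 : ℕ) : ℤ) = k + l - i by push_cast; ring,
      show h + ((i + 1 : ℕ) : ℤ) = h + 1 + i by push_cast; ring, smul_smul, ← add_smul]
    congr 1
    ring
  · simp only [bc_zero_right, Nat.cast_zero]
    congr 2
    ring

end BinExp

/-! ## Delta functions and binomial expansions -/

section Reindex

variable {ι M : Type*} [AddCommGroup M]

theorem finsum_eq_finsum_comp {f : ι → M} {g : ℕ → ι} (hg : Function.Injective g)
    (hf : ∀ x, f x ≠ 0 → x ∈ Set.range g) : ∑ᶠ x, f x = ∑ᶠ i, f (g i) := by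
  rw [← finsum_mem_range hg, ← finsum_mem_univ]
  refine finsum_mem_inter_support_eq f _ _ ?_
  ext x
  simp only [Set.univ_inter, Set.mem_inter_iff, Function.mem_support]
  exact ⟨fun h => ⟨hf x h, h⟩, fun h => h.2⟩

theorem finite_support_of_comp {f : ι → M} {g : ℕ → ι}
    (hf : ∀ x, f x ≠ 0 → x ∈ Set.range g) (h : ∃ N, ∀ i, N ≤ i → f (g i) = 0) :
    (Function.support f).Finite := by
  obtain ⟨N, hN⟩ := h
  refine ((Set.finite_Iio N).image g).subset fun x hx => ?_
  obtain ⟨i, rfl⟩ := hf x hx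
  refine ⟨i, ?_, rfl⟩
  by_contra hc
  exact hx (hN i (by simpa using hc))

end Reindex

theorem binom_natCast (l : ℤ) (i : ℕ) : binom l i = bc l i := by
  simp [binom, bc]

theorem binom_of_neg {l k : ℤ} (hk : k < 0) : binom l k = 0 := by
  simp [binom, hk]

theorem deltaCoeff_ne_zero {s t : ℂ} {i j k : ℤ} (h : deltaCoeff s t i j k ≠ 0) :
    ∃ n : ℕ, j = n ∧ i = -1 - k - n := by
  simp only [deltaCoeff, ne_eq, ite_eq_right_iff, not_forall] at h
  obtain ⟨h1, h2⟩ := h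
  by_cases hj : 0 ≤ j
  · exact ⟨j.toNat, by omega, by omega⟩
  · exact absurd (by rw [binom_of_neg (by omega), mul_zero]) h2

theorem deltaCoeff_natCast (s t : ℂ) (k : ℤ) (n : ℕ) :
    deltaCoeff s t (-1 - k - n) n k = t ^ (k + 1) * s ^ n * bc (-k - 1) n := by
  rw [deltaCoeff, if_pos (by ring), binom_natCast, zpow_natCast]

section Jacobi

variable {V M : Type*} [AddCommGroup V] [Module ℂ V] [AddCommGroup M] [Module ℂ M]

theorem delta12_support (A B : ℤ → Module.End ℂ M) (m : M) (e0 e1 e2 : ℤ) (x : ℤ × ℤ × ℤ)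
    (hx : delta12 x • prod12 A B m ((e0, e1, e2) - x) ≠ 0) :
    x ∈ Set.range fun i : ℕ => ((e0, -1 - e0 - i, (i : ℤ)) : ℤ × ℤ × ℤ) := by
  obtain ⟨x0, x1, x2⟩ := x
  rw [ne_eq, smul_eq_zero, not_or] at hx
  obtain ⟨n, h1, h2⟩ := deltaCoeff_ne_zero hx.1
  simp only [prod12, Prod.mk_sub_mk, ite_eq_right_iff, not_forall] at hx h1 h2
  obtain ⟨h3, -⟩ := hx.2
  exact ⟨n, by ext <;> simp <;> omega⟩

theorem delta12_term (A B : ℤ → Module.End ℂ M) (m : M) (e0 e1 e2 : ℤ) (i : ℕ) :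
    delta12 (e0, -1 - e0 - i, (i : ℤ)) • prod12 A B m ((e0, e1, e2) - (e0, -1 - e0 - i, (i : ℤ))) =
      ((-1) ^ i * bc (-e0 - 1) i) • A (-e1 - 1 + (-e0 - 1) - i) (B (-e2 - 1 + i) m) := by
  rw [delta12, deltaCoeff_natCast, one_zpow, one_mul]
  simp only [prod12, Prod.mk_sub_mk, sub_self, if_true]
  congr 3
  · ring
  · congr 2; ring

theorem delta21_support (A B : ℤ → Module.End ℂ M) (m : M) (e0 e1 e2 : ℤ) (x : ℤ × ℤ × ℤ)
    (hx : delta21 x • prod21 A B m ((e0, e1, e2) - x) ≠ 0) :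
    x ∈ Set.range fun i : ℕ => ((e0, (i : ℤ), -1 - e0 - i) : ℤ × ℤ × ℤ) := by
  obtain ⟨x0, x1, x2⟩ := x
  rw [ne_eq, smul_eq_zero, not_or] at hx
  obtain ⟨n, h1, h2⟩ := deltaCoeff_ne_zero hx.1
  simp only [prod21, Prod.mk_sub_mk, ite_eq_right_iff, not_forall] at hx h1 h2
  obtain ⟨h3, -⟩ := hx.2
  exact ⟨n, by ext <;> simp <;> omega⟩

theorem neg_one_zpow_neg (l : ℤ) : (-1 : ℂ) ^ (-l) = (-1) ^ l := by
  rw [zpow_neg, ← inv_zpow, inv_neg, inv_one]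

theorem delta21_term (A B : ℤ → Module.End ℂ M) (m : M) (e0 e1 e2 : ℤ) (i : ℕ) :
    delta21 (e0, (i : ℤ), -1 - e0 - i) • prod21 A B m ((e0, e1, e2) - (e0, (i : ℤ), -1 - e0 - i)) =
      (-1 : ℂ) ^ (-e0 - 1) • ((-1) ^ i * bc (-e0 - 1) i) •
        B (-e2 - 1 + (-e0 - 1) - i) (A (-e1 - 1 + i) m) := by
  rw [delta21, deltaCoeff_natCast, smul_smul, ← mul_assoc, ← neg_one_zpow_neg (-e0 - 1),
    show -(-e0 - 1) = e0 + 1 by ring]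
  simp only [prod21, Prod.mk_sub_mk, sub_self, if_true]
  congr 3
  · ring
  · congr 2; ring

theorem delta10_support (Y : V → ℤ → Module.End ℂ V) (YM : V → ℤ → Module.End ℂ M) (u v : V)
    (m : M) (e0 e1 e2 : ℤ) (x : ℤ × ℤ × ℤ)
    (hx : delta10 x • iterate02 Y YM u v m ((e0, e1, e2) - x) ≠ 0) :
    x ∈ Set.range fun i : ℕ => (((i : ℤ), e1, -1 - e1 - i) : ℤ × ℤ × ℤ) := by
  obtain ⟨x0, x1, x2⟩ := x
  rw [ne_eq, smul_eq_zero, not_or] at hx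
  obtain ⟨n, h1, h2⟩ := deltaCoeff_ne_zero hx.1
  simp only [iterate02, Prod.mk_sub_mk, ite_eq_right_iff, not_forall] at hx h1 h2
  obtain ⟨h3, -⟩ := hx.2
  exact ⟨n, by ext <;> simp <;> omega⟩

/-- The sign `(-1)^i` of the expansion disappears on negating the upper index: this is `x₂⁻¹ δ((x₁ -
x₀)/x₂) = x₁⁻¹ δ((x₂ + x₀)/x₁)`, so the iterate is paired with powers of `x₂ + x₀`. -/
theorem delta10_term (Y : V → ℤ → Module.End ℂ V) (YM : V → ℤ → Module.End ℂ M) (u v : V)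
    (m : M) (e0 e1 e2 : ℤ) (i : ℕ) :
    delta10 ((i : ℤ), e1, -1 - e1 - i) •
        iterate02 Y YM u v m ((e0, e1, e2) - ((i : ℤ), e1, -1 - e1 - i)) =
      ((1 : ℂ) ^ i * bc (-e1 - 1) i) •
        YM (Y u (-e0 - 1 + i) v) (-e2 - 1 + (-e1 - 1) - i) m := by
  have h : delta10 ((i : ℤ), e1, -1 - e1 - i) = (1 : ℂ) ^ i * bc (-e1 - 1) i := by
    rw [delta10]
    have := deltaCoeff_natCast (-1) 1 (-1 - e1 - i) i
    simp only at this ⊢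
    rw [show -1 - (-1 - e1 - (i : ℤ)) - i = e1 by ring] at this
    rw [this, show -(-1 - e1 - (i : ℤ)) - 1 = -(-e1 - i) by ring, bc_neg, one_zpow, one_mul,
      ← mul_assoc, ← pow_add, ← two_mul, pow_mul]
    norm_num
  rw [h]
  simp only [iterate02, Prod.mk_sub_mk, sub_self, if_true]
  congr 3
  · congr 3; ring
  · ring

theorem fmul_delta12 (A B : ℤ → Module.End ℂ M) (m : M) (e0 e1 e2 : ℤ) :
    fmul delta12 (prod12 A B m) (e0, e1, e2) =
      binExp (-1) (-e0 - 1) (fun k h => A k (B h m)) (-e1 - 1) (-e2 - 1) := by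
  rw [fmul, finsum_eq_finsum_comp (fun i j h => by simpa using h)
    (delta12_support A B m e0 e1 e2)]
  exact finsum_congr fun i => delta12_term A B m e0 e1 e2 i

theorem fmul_delta21 (A B : ℤ → Module.End ℂ M) (m : M) (e0 e1 e2 : ℤ) :
    fmul delta21 (prod21 A B m) (e0, e1, e2) = (-1 : ℂ) ^ (-e0 - 1) •
      binExp (-1) (-e0 - 1) (fun h k => B h (A k m)) (-e2 - 1) (-e1 - 1) := by
  rw [fmul, finsum_eq_finsum_comp (fun i j h => by simpa using h)
    (delta21_support A B m e0 e1 e2), binExp, smul_finsum]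
  exact finsum_congr fun i => delta21_term A B m e0 e1 e2 i

theorem fmul_delta10 (Y : V → ℤ → Module.End ℂ V) (YM : V → ℤ → Module.End ℂ M) (u v : V)
    (m : M) (e0 e1 e2 : ℤ) :
    fmul delta10 (iterate02 Y YM u v m) (e0, e1, e2) =
      binExp 1 (-e1 - 1) (fun k j => YM (Y u j v) k m) (-e2 - 1) (-e0 - 1) := by
  rw [fmul, finsum_eq_finsum_comp (fun i j h => by simpa using h)
    (delta10_support Y YM u v m e0 e1 e2)]
  exact finsum_congr fun i => delta10_term Y YM u v m e0 e1 e2 i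

/-- The Jacobi identity in terms of modes (Borcherds' identity). -/
theorem JacobiOn.modes {Y : V → ℤ → Module.End ℂ V} {YM : V → ℤ → Module.End ℂ M} {u v : V}
    {m : M} (hJ : JacobiOn Y YM u v m) (l k h : ℤ) :
    binExp (-1) l (fun k h => YM u k (YM v h m)) k h -
        (-1 : ℂ) ^ l • binExp (-1) l (fun h k => YM v h (YM u k m)) h k =
      binExp 1 k (fun h j => YM (Y u j v) h m) h l := by
  have := congrFun hJ.2.2.2 (-l - 1, -k - 1, -h - 1)
  rw [Pi.sub_apply, fmul_delta12, fmul_delta21, fmul_delta10] at this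
  simpa only [neg_sub, sub_neg_eq_add, add_sub_cancel_left] using this

theorem jacobiOn_of_modes {Y : V → ℤ → Module.End ℂ V} {YM : V → ℤ → Module.End ℂ M} {u v : V}
    {m : M} (hu : ∃ N : ℤ, ∀ n ≥ N, YM u n m = 0) (hv : ∃ N : ℤ, ∀ n ≥ N, YM v n m = 0)
    (hY : ∃ N : ℤ, ∀ n ≥ N, ∀ k, YM (Y u n v) k m = 0)
    (hJ : ∀ l k h : ℤ, binExp (-1) l (fun k h => YM u k (YM v h m)) k h -
        (-1 : ℂ) ^ l • binExp (-1) l (fun h k => YM v h (YM u k m)) h k =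
      binExp 1 k (fun h j => YM (Y u j v) h m) h l) : JacobiOn Y YM u v m := by
  refine ⟨?_, ?_, ?_, ?_⟩
  · rintro ⟨e0, e1, e2⟩
    obtain ⟨N, hN⟩ := hv
    refine finite_support_of_comp (delta12_support _ _ m e0 e1 e2)
      ⟨(N + e2 + 1).toNat, fun i hi => ?_⟩
    rw [delta12_term, hN _ (by omega), map_zero, smul_zero]
  · rintro ⟨e0, e1, e2⟩
    obtain ⟨N, hN⟩ := hu
    refine finite_support_of_comp (delta21_support _ _ m e0 e1 e2)
      ⟨(N + e1 + 1).toNat, fun i hi => ?_⟩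
    rw [delta21_term, hN _ (by omega), map_zero, smul_zero, smul_zero]
  · rintro ⟨e0, e1, e2⟩
    obtain ⟨N, hN⟩ := hY
    refine finite_support_of_comp (delta10_support Y YM u v m e0 e1 e2)
      ⟨(N + e0 + 1).toNat, fun i hi => ?_⟩
    rw [delta10_term, hN _ (by omega), smul_zero]
  · ext ⟨e0, e1, e2⟩
    rw [Pi.sub_apply, fmul_delta12, fmul_delta21, fmul_delta10]
    exact hJ _ _ _

end Jacobi

/-! ### Modes of the actions on `W₁`, on `W₂` and on functionals -/

section Action

variable {V : Type*} [AddCommGroup V] [Module ℂ V] {A : VertexOperatorAlgebra V}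
  {W₁ : Type*} [AddCommGroup W₁] [Module ℂ W₁] {W₂ : Type*} [AddCommGroup W₂] [Module ℂ W₂]

/-- The action of `v ⊗ t^n (z + t)^k` on `W₁` through the opposite vertex operators. -/
def starMode (M₁ : VOAModule A W₁) (z : ℂ) (v : V) (n k : ℤ) : Module.End ℂ W₁ :=
  starPart M₁ z v (-n - 1, -k - 1)

/-- The action of `v ⊗ t^n (z + t)^k` on `W₂`. -/
def plusMode (M₂ : VOAModule A W₂) (z : ℂ) (v : V) (n k : ℤ) : Module.End ℂ W₂ :=
  plusPart M₂ z v (-n - 1, -k - 1)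

/-- The action of `v ⊗ t^n (z + t)^k` on the dual of `W₁ ⊗ W₂`. -/
def tauMode (M₁ : VOAModule A W₁) (M₂ : VOAModule A W₂) (z : ℂ) (v : V) (n k : ℤ) :
    Module.End ℂ (Module.Dual ℂ (W₁ ⊗[ℂ] W₂)) :=
  tauQ M₁ M₂ z v (-n - 1, -k - 1)

theorem YQ_eq_tauMode (M₁ : VOAModule A W₁) (M₂ : VOAModule A W₂) (z : ℂ) (v : V) (n : ℤ) :
    YQ M₁ M₂ z v n = tauMode M₁ M₂ z v n 0 := by
  simp [YQ, tauMode]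

theorem tauMode_apply_tmul (M₁ : VOAModule A W₁) (M₂ : VOAModule A W₂) (z : ℂ) (v : V) (n k : ℤ)
    (lam : Module.Dual ℂ (W₁ ⊗[ℂ] W₂)) (w₁ : W₁) (w₂ : W₂) :
    tauMode M₁ M₂ z v n k lam (w₁ ⊗ₜ w₂) =
      lam (starMode M₁ z v n k w₁ ⊗ₜ w₂) - lam (w₁ ⊗ₜ plusMode M₂ z v n k w₂) := by
  simp [tauMode, tauQ, starMode, plusMode]

theorem starMode_apply (M₁ : VOAModule A W₁) (z : ℂ) (v : V) (n k : ℤ) (w : W₁) :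
    starMode M₁ z v n k w = binExp (-z) n (fun p _ => M₁.Ystar v p w) k 0 := by
  change fmul (deltaX1Z z) (inX1 (ofModes fun n => M₁.Ystar v n w)) (-n - 1, -k - 1) = _
  rw [fmul, finsum_eq_finsum_comp (g := fun i : ℕ => ((-n - 1, n - i) : ℤ × ℤ))
    (fun i j h => by simpa using h)]
  · refine finsum_congr fun i => ?_
    have h := deltaCoeff_natCast (-1) 1 (-n - 1) i
    rw [show -1 - (-n - 1) - (i : ℤ) = n - i by ring, one_zpow, one_mul,
      show -(-n - 1) - 1 = n by ring] at h
    simp only [deltaX1Z, show -1 - (-n - 1) - (n - (i : ℤ)) = i by ring, h, inX1, ofModes,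
      Prod.mk_sub_mk, sub_self, if_true, zpow_natCast]
    refine congrArg₂ (· • ·) ?_ ?_
    · rw [neg_pow]; ring
    · rw [show -(-k - 1 - (n - (i : ℤ))) - 1 = k + n - i by ring]
  · rintro ⟨x0, x1⟩ hx
    rw [ne_eq, smul_eq_zero, not_or] at hx
    simp only [deltaX1Z, mul_eq_zero, not_or, inX1, Prod.mk_sub_mk, ite_eq_right_iff,
      not_forall] at hx
    obtain ⟨⟨h1, -⟩, h2, -⟩ := hx
    obtain ⟨i, h3, h4⟩ := deltaCoeff_ne_zero h1
    exact ⟨i, by ext <;> simp <;> omega⟩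

theorem plusMode_apply (M₂ : VOAModule A W₂) (z : ℂ) (v : V) (n k : ℤ) (w : W₂) :
    plusMode M₂ z v n k w = binExp 1 n (fun p q => (-z) ^ p • M₂.Y v q w) 0 k := by
  change fmul (deltaZX1 z) (inX1 (ofModes fun n => M₂.Y v n w)) (-n - 1, -k - 1) = _
  rw [fmul, finsum_eq_finsum_comp (g := fun i : ℕ => ((-n - 1, (i : ℤ)) : ℤ × ℤ))
    (fun i j h => by simpa using h)]
  · refine finsum_congr fun i => ?_
    have h := deltaCoeff_natCast (-1) (-1) (-n - 1) i
    rw [show -(-n - 1) - 1 = n by ring] at h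
    simp only [deltaZX1, h, inX1, ofModes, Prod.mk_sub_mk, sub_self, if_true, smul_smul]
    refine congrArg₂ (· • ·) ?_ ?_
    · have h1 : (-z) ^ (0 + n - (i : ℤ)) = (-1) ^ (n - (i : ℤ)) * z ^ (n - (i : ℤ)) := by
        rw [← mul_zpow, neg_one_mul, zero_add]
      have h2 : (-1 : ℂ) ^ (n - (i : ℤ)) = (-1 : ℂ) ^ (-n - 1 + 1) * (-1) ^ i := by
        rw [show -n - 1 + 1 = -n by ring, neg_one_zpow_neg, zpow_sub₀ (by norm_num), zpow_natCast,
          div_eq_mul_inv, ← inv_pow, inv_neg, inv_one]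
      rw [h1, h2, show -1 - (-n - 1) - (i : ℤ) = n - i by ring]
      ring
    · rw [show -(-k - 1 - (i : ℤ)) - 1 = k + i by ring]
  · rintro ⟨x0, x1⟩ hx
    rw [ne_eq, smul_eq_zero, not_or] at hx
    simp only [deltaZX1, mul_eq_zero, not_or, inX1, Prod.mk_sub_mk, ite_eq_right_iff,
      not_forall] at hx
    obtain ⟨⟨h1, -⟩, h2, -⟩ := hx
    obtain ⟨i, h3, h4⟩ := deltaCoeff_ne_zero h1
    exact ⟨i, by ext <;> simp <;> omega⟩

theorem trunc_Ystar (M₁ : VOAModule A W₁) (v : V) (w : W₁) :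
    Trunc fun p _ => M₁.Ystar v p w := by
  obtain ⟨N, hN⟩ := M₁.Ystar_truncation v w
  exact fun k h => ⟨(k - N).toNat, fun i hi => hN _ (by omega)⟩

theorem trunc_smul_Y (M₂ : VOAModule A W₂) (z : ℂ) (v : V) (w : W₂) :
    Trunc fun p q => (-z) ^ p • M₂.Y v q w := by
  obtain ⟨N, hN⟩ := M₂.truncation v w
  exact fun k h => ⟨(N - h).toNat, fun i hi => by simp only [hN (h + i) (by omega), smul_zero]⟩

theorem starMode_zero (M₁ : VOAModule A W₁) (z : ℂ) (v : V) (k : ℤ) :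
    starMode M₁ z v 0 k = M₁.Ystar v k := by
  ext w
  rw [starMode_apply, binExp_zero]

theorem plusMode_zero (M₂ : VOAModule A W₂) (z : ℂ) (v : V) (k : ℤ) :
    plusMode M₂ z v 0 k = M₂.Y v k := by
  ext w
  rw [plusMode_apply, binExp_zero, zpow_zero, one_smul]

theorem starMode_succ (M₁ : VOAModule A W₁) (z : ℂ) (v : V) (n k : ℤ) :
    starMode M₁ z v (n + 1) k = starMode M₁ z v n (k + 1) - z • starMode M₁ z v n k := by
  ext w
  rw [LinearMap.sub_apply, LinearMap.smul_apply, starMode_apply, starMode_apply, starMode_apply,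
    binExp_succ _ _ (trunc_Ystar M₁ v w), neg_smul, sub_eq_add_neg]
  rfl

theorem plusMode_succ (M₂ : VOAModule A W₂) {z : ℂ} (hz : z ≠ 0) (v : V) (n k : ℤ) :
    plusMode M₂ z v (n + 1) k = plusMode M₂ z v n (k + 1) - z • plusMode M₂ z v n k := by
  ext w
  rw [LinearMap.sub_apply, LinearMap.smul_apply, plusMode_apply, plusMode_apply,
    plusMode_apply, binExp_succ _ _ (trunc_smul_Y M₂ z v w), one_smul, add_comm,
    sub_eq_add_neg, ← neg_smul]
  congr 1
  rw [← binExp_smul, ← add_zero k, ← binExp_shift, add_zero]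
  refine binExp_congr fun i => ?_
  -- The exponent of `-z` may be negative, so the recursion needs `z ≠ 0` here, unlike the one on
  -- `W₁`.
  rw [zpow_add_one₀ (neg_ne_zero.2 hz), smul_smul, mul_comm, add_zero]

theorem tauMode_succ (M₁ : VOAModule A W₁) (M₂ : VOAModule A W₂) {z : ℂ} (hz : z ≠ 0) (v : V)
    (n k : ℤ) : tauMode M₁ M₂ z v (n + 1) k =
      tauMode M₁ M₂ z v n (k + 1) - z • tauMode M₁ M₂ z v n k := by
  refine LinearMap.ext fun lam => TensorProduct.ext' fun w₁ w₂ => ?_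
  simp only [LinearMap.sub_apply, LinearMap.smul_apply, tauMode_apply_tmul, starMode_succ,
    plusMode_succ M₂ hz, TensorProduct.sub_tmul, TensorProduct.tmul_sub, map_sub,
    ← TensorProduct.smul_tmul', TensorProduct.tmul_smul, map_smul, smul_eq_mul]
  ring

theorem starMode_truncation (M₁ : VOAModule A W₁) (z : ℂ) (v : V) (n : ℤ) (w : W₁) :
    ∃ N : ℤ, ∀ k ≤ N, starMode M₁ z v n k w = 0 := by
  obtain ⟨N, hN⟩ := M₁.Ystar_truncation v w
  refine ⟨N - n, fun k hk => ?_⟩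
  rw [starMode_apply]
  exact binExp_eq_zero fun i => hN _ (by omega)

theorem plusMode_truncation (M₂ : VOAModule A W₂) (z : ℂ) (v : V) (n : ℤ) (w : W₂) :
    ∃ N : ℤ, ∀ k ≥ N, plusMode M₂ z v n k w = 0 := by
  obtain ⟨N, hN⟩ := M₂.truncation v w
  refine ⟨N, fun k hk => ?_⟩
  rw [plusMode_apply]
  exact binExp_eq_zero fun i => by simp only [hN (k + i) (by omega), smul_zero]

/-- By condition (b) the coefficient of `x₀^{-n-1} x₁^{-k-1}` combines only modes `YQ` of index `n +
i` with `i ≥ 0`, because the delta function contains nonnegative powers of `x₀` alone. Hence the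
bound from condition (a) serves for every `k`. -/
theorem Compatible.tauMode_truncation {M₁ : VOAModule A W₁} {M₂ : VOAModule A W₂} {z : ℂ}
    {lam : Module.Dual ℂ (W₁ ⊗[ℂ] W₂)} (hlam : Compatible M₁ M₂ z lam) (v : V) :
    ∃ N : ℤ, ∀ n ≥ N, ∀ k, tauMode M₁ M₂ z v n k lam = 0 := by
  obtain ⟨N, hN⟩ := hlam.1 v
  refine ⟨N, fun n hn k => ?_⟩
  have h := congrFun (hlam.2 v) (-n - 1, -k - 1)
  rw [tauMode, h, fmul]
  refine finsum_eq_zero_of_forall_eq_zero fun x => ?_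
  obtain ⟨x0, x1⟩ := x
  by_contra hx
  rw [smul_eq_zero, not_or] at hx
  simp only [deltaZX0, mul_eq_zero, not_or, inX0, ofModes, Prod.mk_sub_mk, ite_eq_right_iff,
    not_forall] at hx
  obtain ⟨⟨h1, -⟩, h2, h3⟩ := hx
  obtain ⟨i, h4, h5⟩ := deltaCoeff_ne_zero h1
  exact h3 (hN _ (by omega))

end Action

/-! ## The Jacobi identity for the opposite vertex operators -/

section Antidiagonal

variable {M : Type*} [AddCommGroup M]

theorem sum_antidiagonal_succ_left {G : ℕ → ℕ → M} (hG : ∀ j, G 0 j = 0) (s : ℕ) :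
    ∑ p ∈ Finset.HasAntidiagonal.antidiagonal s, G (p.1 + 1) p.2 =
      ∑ p ∈ Finset.HasAntidiagonal.antidiagonal (s + 1), G p.1 p.2 := by
  rw [Finset.Nat.sum_antidiagonal_succ (f := fun p => G p.1 p.2), hG, zero_add]

theorem sum_antidiagonal_succ_right {G : ℕ → ℕ → M} (hG : ∀ i, G i 0 = 0) (s : ℕ) :
    ∑ p ∈ Finset.HasAntidiagonal.antidiagonal s, G p.1 (p.2 + 1) =
      ∑ p ∈ Finset.HasAntidiagonal.antidiagonal (s + 1), G p.1 p.2 := by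
  rw [Finset.Nat.sum_antidiagonal_succ' (f := fun p => G p.1 p.2), hG, zero_add]

/-- Euler's relation for divided powers: after shifting indices, each term of total degree `s + 1`
is counted `p.1 + p.2` times. It drives the inductions on powers of `L(1)`. -/
theorem sum_antidiagonal_derivation [Module ℂ M] (T : ℕ → ℕ → M) (s : ℕ) :
    ∑ p ∈ Finset.HasAntidiagonal.antidiagonal s, (((p.1 : ℂ) + 1) • T (p.1 + 1) p.2 +
      ((p.2 : ℂ) + 1) • T p.1 (p.2 + 1)) =
        ((s : ℂ) + 1) • ∑ p ∈ Finset.HasAntidiagonal.antidiagonal (s + 1), T p.1 p.2 := by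
  have h1 := sum_antidiagonal_succ_left (G := fun i j => (i : ℂ) • T i j) (by simp) s
  have h2 := sum_antidiagonal_succ_right (G := fun i j => (j : ℂ) • T i j) (by simp) s
  push_cast at h1 h2
  rw [Finset.sum_add_distrib, h1, h2, ← Finset.sum_add_distrib, Finset.smul_sum]
  refine Finset.sum_congr rfl fun p hp => ?_
  rw [← add_smul]
  congr 1
  exact_mod_cast Finset.HasAntidiagonal.mem_antidiagonal.1 hp

theorem sum_range_sum_antidiagonal {f : ℕ → ℕ → M} {N : ℕ} (hf : ∀ i j, N ≤ i + j → f i j = 0) :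
    ∑ n ∈ Finset.range N, ∑ p ∈ Finset.HasAntidiagonal.antidiagonal n, f p.1 p.2 =
      ∑ i ∈ Finset.range N, ∑ j ∈ Finset.range N, f i j := by
  simp only [Finset.Nat.sum_antidiagonal_eq_sum_range_succ f]
  rw [Finset.sum_range_diag_flip]
  refine Finset.sum_congr rfl fun i hi => ?_
  refine Finset.sum_subset (Finset.range_mono (Nat.sub_le _ _)) fun j _ hj => hf i j ?_
  simp only [Finset.mem_range] at hi hj
  omega

end Antidiagonal

/-! ### Commutators with `L(0)` and `L(1)`, and conjugation by `e^{L(1)}` -/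

namespace VertexOperatorAlgebra

variable {V : Type*} [AddCommGroup V] [Module ℂ V] (A : VertexOperatorAlgebra V)

theorem mem_grade_of_L0 {k : ℤ} {v : V} (hv : A.Y A.omega 1 v = (k : ℂ) • v) : v ∈ A.grade k := by
  obtain ⟨s, hs⟩ := A.eq_sum_proj v
  rw [hs]
  refine Submodule.sum_mem _ fun n _ => ?_
  by_cases hn : n = k
  · exact hn ▸ A.proj_mem n v
  · have h1 := A.proj_L0 n v
    rw [hv, map_smul, ← sub_eq_zero, ← sub_smul, smul_eq_zero] at h1
    rcases h1 with h1 | h1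
    · exact absurd (by exact_mod_cast (sub_eq_zero.mp h1).symm) hn
    · rw [h1]; exact Submodule.zero_mem _

theorem trunc_iterate {W : Type*} [AddCommGroup W] [Module ℂ W] (f : V →ₗ[ℂ] (ℤ → Module.End ℂ W))
    (u v : V) (w : W) : Trunc fun k j => f (A.Y u j v) k w := by
  obtain ⟨N, hN⟩ := A.truncation u v
  exact fun k h => ⟨(N - h).toNat, fun i hi => by simp [hN (h + i) (by omega)]⟩

theorem lie_omega_one (v w : V) (n : ℤ) : A.Y A.omega 1 (A.Y v n w) =
    A.Y v n (A.Y A.omega 1 w) + A.Y (A.Y A.omega 1 v) n w - ((n : ℂ) + 1) • A.Y v n w := by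
  have h := (A.jacobi A.omega v w).modes 0 1 n
  rw [binExp_zero, binExp_zero, zpow_zero, one_smul, show (1 : ℤ) = 0 + 1 by ring,
    binExp_succ _ _ (A.trunc_iterate A.Y A.omega v w), binExp_zero, binExp_zero] at h
  rw [sub_eq_iff_eq_add] at h
  norm_num at h
  rw [h, A.derivative]
  simp only [LinearMap.smul_apply, add_sub_cancel_right]
  push_cast
  module

theorem lie_L1 {a : ℤ} {u : V} (hu : u ∈ A.grade a) (w : V) (n : ℤ) : A.L1 (A.Y u n w) =
    A.Y u n (A.L1 w) + A.Y (A.L1 u) n w + (2 * a - n - 2 : ℂ) • A.Y u (n + 1) w := by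
  -- With `l = 0` and `k = 2` this is the commutator of `L(1) = ω_2` with `u_n`; the terms on the
  -- right are `L(-1) u`, `2 L(0) u` and `L(1) u`, and the first two combine into the coefficient
  -- `2a - n - 2`.
  have h := (A.jacobi A.omega u w).modes 0 2 n
  have hT := A.trunc_iterate A.Y A.omega u w
  rw [binExp_zero, binExp_zero, zpow_zero, one_smul, show (2 : ℤ) = 0 + 1 + 1 by ring,
    binExp_succ _ _ hT, binExp_succ _ _ hT, binExp_succ _ _ hT] at h
  simp only [binExp_zero] at h
  rw [sub_eq_iff_eq_add] at h
  norm_num at h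
  rw [L1, h, A.derivative, A.L0_grade a u hu, show n + 1 + 1 - 1 = n + 1 by ring]
  simp only [map_smul, Pi.smul_apply, LinearMap.smul_apply]
  push_cast
  module

theorem Y_mem_grade {a b : ℤ} {u v : V} (hu : u ∈ A.grade a) (hv : v ∈ A.grade b) (n : ℤ) :
    A.Y u n v ∈ A.grade (a + b - n - 1) := by
  apply A.mem_grade_of_L0
  rw [lie_omega_one, A.L0_grade a u hu, A.L0_grade b v hv]
  simp only [map_smul, Pi.smul_apply, LinearMap.smul_apply]
  push_cast
  module

/-- The divided power `L(1)^r / r!`. -/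
def divL1 (r : ℕ) : Module.End ℂ V := (r.factorial : ℂ)⁻¹ • A.L1 ^ r

@[simp] theorem divL1_zero (v : V) : A.divL1 0 v = v := by simp [divL1]

theorem L1_divL1 (r : ℕ) (v : V) : A.L1 (A.divL1 r v) = ((r : ℂ) + 1) • A.divL1 (r + 1) v := by
  have h : ((r : ℂ) + 1) ≠ 0 := by exact_mod_cast r.succ_ne_zero
  rw [divL1, divL1, LinearMap.smul_apply, LinearMap.smul_apply, map_smul, pow_succ', smul_smul,
    Nat.factorial_succ]
  push_cast
  rw [mul_inv, mul_inv_cancel_left₀ h]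
  rfl

theorem divL1_mem {a : ℤ} {v : V} (hv : v ∈ A.grade a) (r : ℕ) : A.divL1 r v ∈ A.grade (a - r) :=
  Submodule.smul_mem _ _ (A.mem_grade_of_L0 (A.L0_L1_pow hv r))

/-- The component of degree `s` of
`Y(e^{(1 - x) L(1)} (1 - x)^{-2 L(0)} u, x / (1 - x))` at the mode `n`. -/
def conjMode (a : ℤ) (u : V) (n : ℤ) (s : ℕ) : Module.End ℂ V :=
  ∑ p ∈ Finset.HasAntidiagonal.antidiagonal s,
    bc (2 * a - n - 2 - p.1) p.2 • A.Y (A.divL1 p.1 u) (n + p.2)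

/-- Thus `conjMode a u n s` is the divided power `ad(L(1))^s / s!` applied to `u_n`. The commutator
of each summand is rearranged by Pascal's rule into the shape of `sum_antidiagonal_derivation` plus
a telescoping error. -/
theorem lie_conjMode {a : ℤ} {u : V} (hu : u ∈ A.grade a) (n : ℤ) (s : ℕ) (w : V) :
    A.L1 (A.conjMode a u n s w) =
      A.conjMode a u n s (A.L1 w) + ((s : ℂ) + 1) • A.conjMode a u n (s + 1) w := by
  set B : ℕ → ℕ → V := fun j i => A.Y (A.divL1 j u) (n + i) w with hB
  set c : ℕ → ℕ → ℂ := fun j i => bc (2 * a - n - 2 - j) i with hc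
  -- The telescoping error. It vanishes when either index is `0`, so `G (j + 1) i` and `G j (i + 1)`
  -- have the same sum over the antidiagonal.
  let G : ℕ → ℕ → V := fun j i => Nat.casesOn i 0 fun i => ((j : ℂ) * c j i) • B j (i + 1)
  have hcs : ∀ j i, c j (i + 1) = c (j + 1) i + c (j + 1) (i + 1) := fun j i => by
    simp only [hc]
    rw [← bc_succ_succ]
    congr 1
    push_cast
    ring
  have hterm : ∀ j i : ℕ, A.L1 (c j i • B j i) = c j i • A.Y (A.divL1 j u) (n + i) (A.L1 w) +
      ((((j : ℂ) + 1) • c (j + 1) i • B (j + 1) i + ((i : ℂ) + 1) • c j (i + 1) • B j (i + 1)) +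
        (G (j + 1) i - G j (i + 1))) := by
    intro j i
    have h1 : (c j i * (((2 * a - n - 2 - j : ℤ) : ℂ) - i)) = ((i : ℂ) + 1) * c j (i + 1) := by
      rw [hc, succ_mul_bc, mul_comm]
    have h2 : ((j : ℂ) + 1) • c j i • B (j + 1) i =
        ((j : ℂ) + 1) • c (j + 1) i • B (j + 1) i + G (j + 1) i := by
      cases i with
      | zero => simp [G, hc]
      | succ i =>
        simp only [G, hcs j i]
        push_cast
        module
    have h3 : (2 * ((a - j : ℤ) : ℂ) - ((n + i : ℤ) : ℂ) - 2) =
        (((2 * a - n - 2 - j : ℤ) : ℂ) - i) - j := by push_cast; ring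
    have h4 : c j i • ((((2 * a - n - 2 - j : ℤ) : ℂ) - i) - j) • B j (i + 1) =
        ((i : ℂ) + 1) • c j (i + 1) • B j (i + 1) - G j (i + 1) := by
      simp only [G]
      rw [smul_smul, mul_sub, h1]
      module
    rw [map_smul, hB]
    simp only
    rw [A.lie_L1 (A.divL1_mem hu j), L1_divL1, h3]
    simp only [map_smul, Pi.smul_apply, LinearMap.smul_apply, smul_add]
    rw [add_assoc]
    congr 1
    rw [smul_comm, show n + (i : ℤ) + 1 = n + ((i + 1 : ℕ) : ℤ) by push_cast; ring]
    change ((j : ℂ) + 1) • c j i • B (j + 1) i + c j i • _ • B j (i + 1) = _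
    rw [h2, h4]
    abel
  have hG1 := sum_antidiagonal_succ_left (G := G) (fun i => by cases i <;> simp [G]) s
  have hG2 := sum_antidiagonal_succ_right (G := G) (fun i => rfl) s
  simp only [conjMode, LinearMap.sum_apply, LinearMap.smul_apply, map_sum]
  refine (Finset.sum_congr rfl fun p _ => hterm p.1 p.2).trans ?_
  rw [Finset.sum_add_distrib, Finset.sum_add_distrib, Finset.sum_sub_distrib, hG1, hG2, sub_self,
    add_zero, sum_antidiagonal_derivation fun j i => c j i • B j i]

/-- Conjugation of a vertex operator by `e^{L(1)}`. -/
theorem divL1_Y {a : ℤ} {u : V} (hu : u ∈ A.grade a) (n : ℤ) (v : V) (r : ℕ) :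
    A.divL1 r (A.Y u n v) = ∑ p ∈ Finset.HasAntidiagonal.antidiagonal r,
      A.conjMode a u n p.1 (A.divL1 p.2 v) := by
  induction r with
  | zero => simp [conjMode]
  | succ r ih =>
    have h : ((r : ℂ) + 1) ≠ 0 := by exact_mod_cast r.succ_ne_zero
    apply smul_right_injective V h
    simp only
    rw [← L1_divL1, ih, map_sum, ← sum_antidiagonal_derivation fun s j =>
      A.conjMode a u n s (A.divL1 j v)]
    refine Finset.sum_congr rfl fun p _ => ?_
    rw [A.lie_conjMode hu, L1_divL1, map_smul, add_comm]

/-- The weight of the last vector is `a + b - l - 1 - (i + j + I)`, and weights are bounded below; a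
single `N` therefore makes all sums below finite. -/
theorem exists_divL1_bound {a b : ℤ} {u v : V} (hu : u ∈ A.grade a) (hv : v ∈ A.grade b) (l : ℤ) :
    ∃ N : ℕ, (∀ r, N ≤ r → A.divL1 r u = 0) ∧ (∀ r, N ≤ r → A.divL1 r v = 0) ∧
      ∀ i j I : ℕ, N ≤ i + j + I → A.Y (A.divL1 i u) (l + I) (A.divL1 j v) = 0 := by
  obtain ⟨B, hB⟩ := A.grade_bounded
  refine ⟨max (max (a - B + 1).toNat (b - B + 1).toNat) (a + b - l - B).toNat,
    fun r hr => ?_, fun r hr => ?_, fun i j I hr => ?_⟩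
  · exact (Submodule.mem_bot ℂ).1 (hB (a - r) (by omega) ▸ A.divL1_mem hu r)
  · exact (Submodule.mem_bot ℂ).1 (hB (b - r) (by omega) ▸ A.divL1_mem hv r)
  · exact (Submodule.mem_bot ℂ).1 (hB (a - i + (b - j) - (l + I) - 1) (by omega) ▸
      A.Y_mem_grade (A.divL1_mem hu i) (A.divL1_mem hv j) (l + I))

end VertexOperatorAlgebra

/-! ### Borcherds' identity for the opposite vertex operators -/

namespace VOAModule

variable {V : Type*} [AddCommGroup V] [Module ℂ V] {A : VertexOperatorAlgebra V}
  {W : Type*} [AddCommGroup W] [Module ℂ W] (M : VOAModule A W)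

theorem Ystar_add (u v : V) (p : ℤ) : M.Ystar (u + v) p = M.Ystar u p + M.Ystar v p := by
  have hfin : ∀ v, (Function.support fun q : ℤ × ℕ => ((-1 : ℂ) ^ q.1 / (q.2.factorial : ℂ)) •
      M.Y ((A.L1 ^ q.2) (A.proj q.1 v)) (2 * q.1 - q.2 - p - 2)).Finite := fun v =>
    (A.L1_pow_finite v).subset fun q hq h0 => hq (by simp [h0])
  rw [Ystar, Ystar, Ystar, ← finsum_add_distrib (hfin u) (hfin v)]
  simp only [map_add, Pi.add_apply, smul_add]

theorem Ystar_zero (p : ℤ) : M.Ystar 0 p = 0 := by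
  simpa using M.Ystar_add 0 0 p

theorem Ystar_of_mem_grade {a : ℤ} {v : V} (hv : v ∈ A.grade a) {N : ℕ}
    (hN : ∀ r, N ≤ r → A.divL1 r v = 0) (p : ℤ) : M.Ystar v p =
      ∑ r ∈ Finset.range N, (-1 : ℂ) ^ a • M.Y (A.divL1 r v) (2 * a - r - p - 2) := by
  have hterm : ∀ r : ℕ, ((-1 : ℂ) ^ a / (r.factorial : ℂ)) •
      M.Y ((A.L1 ^ r) (A.proj a v)) (2 * a - r - p - 2) =
        (-1 : ℂ) ^ a • M.Y (A.divL1 r v) (2 * a - r - p - 2) := fun r => by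
    rw [A.proj_of_mem hv, if_pos rfl, VertexOperatorAlgebra.divL1, LinearMap.smul_apply, map_smul,
      Pi.smul_apply, smul_smul, div_eq_mul_inv]
  rw [Ystar, finsum_eq_finsum_comp (g := fun r : ℕ => ((a, r) : ℤ × ℕ))
    (fun i j h => by simpa using h)]
  · simp only [hterm]
    exact finsum_eq_sum_range fun r hr => by simp [hN r hr]
  · rintro ⟨h, r⟩ hq
    by_cases ha : h = a
    · exact ⟨r, by rw [ha]⟩
    · exact absurd (by rw [A.proj_of_mem hv, if_neg ha]; simp) hq

theorem trunc_Ystar_Ystar (u v : V) (w : W) : Trunc fun k h => M.Ystar v h (M.Ystar u k w) := by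
  obtain ⟨N, hN⟩ := M.Ystar_truncation u w
  exact fun k h => ⟨(k - N).toNat, fun i hi => by simp only [hN (k - i) (by omega), map_zero]⟩

theorem trunc_iterate_Ystar (u v : V) (w : W) : Trunc fun h j => M.Ystar (A.Y u j v) h w := by
  obtain ⟨N, hN⟩ := A.truncation u v
  exact fun k h => ⟨(N - h).toNat, fun i hi => by
    simp only [hN (h + i) (by omega), Ystar_zero, LinearMap.zero_apply]⟩

/-- The value on `w` of the opposite Jacobi identity
`x₀⁻¹ δ((x₁ - x₂)/x₀) Y*(v, x₂) Y*(u, x₁) - x₀⁻¹ δ((x₂ - x₁)/(-x₀)) Y*(u, x₁) Y*(v, x₂)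
= x₂⁻¹ δ((x₁ - x₀)/x₂) Y*(Y(u, x₀) v, x₂)` in terms of modes. -/
def OppositeJacobiOn (u v : V) (w : W) : Prop := ∀ l k h : ℤ,
  binExp (-1) l (fun k h => M.Ystar v h (M.Ystar u k w)) k h -
      (-1 : ℂ) ^ l • binExp (-1) l (fun h k => M.Ystar u k (M.Ystar v h w)) h k =
    binExp 1 k (fun h j => M.Ystar (A.Y u j v) h w) h l

/-- The iterate side of the opposite Jacobi identity, for homogeneous vectors. -/
theorem binExp_iterate_Ystar {a b : ℤ} {u v : V} (hu : u ∈ A.grade a) (hv : v ∈ A.grade b) {l : ℤ}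
    {N : ℕ} (hN : ∀ i j I : ℕ, N ≤ i + j + I →
      A.Y (A.divL1 i u) (l + I) (A.divL1 j v) = 0) (k h : ℤ) (w : W) :
    binExp 1 k (fun h j => M.Ystar (A.Y u j v) h w) h l =
      ∑ i ∈ Finset.range N, ∑ j ∈ Finset.range N, (-1 : ℂ) ^ (a + b - l - 1) •
        ∑ I ∈ Finset.range N, bc (2 * a - l - 2 - i - k) I •
          M.Y (A.Y (A.divL1 i u) (l + I) (A.divL1 j v))
            (2 * a + 2 * b - 2 * l - 4 - k - h - i - j - I) w := by
  set G : ℕ → ℕ → ℕ → W := fun i j I => M.Y (A.Y (A.divL1 i u) (l + I) (A.divL1 j v))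
    (2 * a + 2 * b - 2 * l - 4 - k - h - i - j - I) w with hGdef
  have hG : ∀ i j I, N ≤ i + j + I → G i j I = 0 := fun i j I h => by simp [hGdef, hN i j I h]
  have hzero : ∀ m : ℕ, N ≤ m → A.Y u (l + m) v = 0 := fun m hm => by
    simpa using hN 0 0 m (by omega)
  -- the iterates, conjugated by `e^{L(1)}`
  have hdiv : ∀ m r : ℕ, A.divL1 r (A.Y u (l + m) v) =
      ∑ p ∈ Finset.HasAntidiagonal.antidiagonal r,
        ∑ q ∈ Finset.HasAntidiagonal.antidiagonal p.1, bc (2 * a - (l + m) - 2 - q.1) q.2 •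
          A.Y (A.divL1 q.1 u) (l + ((m + q.2 : ℕ) : ℤ)) (A.divL1 p.2 v) := fun m r => by
    rw [A.divL1_Y hu]
    simp only [VertexOperatorAlgebra.conjMode, LinearMap.sum_apply, LinearMap.smul_apply]
    push_cast
    simp only [add_assoc]
  have hbound : ∀ m r : ℕ, N ≤ r → A.divL1 r (A.Y u (l + m) v) = 0 := fun m r hr => by
    rw [hdiv]
    refine Finset.sum_eq_zero fun p hp => Finset.sum_eq_zero fun q hq => ?_
    have hp' := Finset.HasAntidiagonal.mem_antidiagonal.1 hp
    have hq' := Finset.HasAntidiagonal.mem_antidiagonal.1 hq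
    rw [hN _ _ _ (by omega), smul_zero]
  have hstar : ∀ m : ℕ, M.Ystar (A.Y u (l + m) v) (h + k - m) w =
      ∑ i ∈ Finset.range N, ∑ j ∈ Finset.range N, ∑ n ∈ Finset.range N,
        ((-1 : ℂ) ^ (a + b - l - 1) * ((-1) ^ m * bc (2 * a - l - 2 - i - m) n)) •
          G i j (m + n) := fun m => by
    rw [M.Ystar_of_mem_grade (A.Y_mem_grade hu hv (l + m)) (hbound m), LinearMap.sum_apply]
    let F : ℕ → ℕ → ℕ → W := fun i n j =>
      ((-1 : ℂ) ^ (a + b - l - 1) * ((-1) ^ m * bc (2 * a - l - 2 - i - m) n)) • G i j (m + n)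
    have hF : ∀ i n j, N ≤ i + n + j → F i n j = 0 := fun i n j hij => by
      simp only [F, hG i j (m + n) (by omega), smul_zero]
    have hr : ∀ r ∈ Finset.range N, ((-1 : ℂ) ^ (a + b - (l + m) - 1) •
        M.Y (A.divL1 r (A.Y u (l + m) v)) (2 * (a + b - (l + m) - 1) - r - (h + k - m) - 2)) w =
          ∑ p ∈ Finset.HasAntidiagonal.antidiagonal r,
            ∑ q ∈ Finset.HasAntidiagonal.antidiagonal p.1, F q.1 q.2 p.2 := fun r _ => by
      rw [hdiv]
      simp only [map_sum, map_smul, Finset.sum_apply, Pi.smul_apply, LinearMap.sum_apply,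
        LinearMap.smul_apply, Finset.smul_sum]
      refine Finset.sum_congr rfl fun p hp => Finset.sum_congr rfl fun q hq => ?_
      have hp' := Finset.HasAntidiagonal.mem_antidiagonal.1 hp
      have hq' := Finset.HasAntidiagonal.mem_antidiagonal.1 hq
      -- The vector `u_{l+m} v` has weight `a + b - l - m - 1`, so its opposite modes carry a sign
      -- alternating with `m`; this is the sign needed to sum over `m` below.
      have hsign : (-1 : ℂ) ^ (a + b - (l + m) - 1) = (-1) ^ (a + b - l - 1) * (-1) ^ m := by
        rw [show a + b - (l + m) - 1 = (a + b - l - 1) + -m by ring, zpow_add₀ (by norm_num),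
          neg_one_zpow_neg, zpow_natCast]
      simp only [F, G]
      rw [hsign, smul_smul, mul_assoc, show 2 * a - (l + m) - 2 - (q.1 : ℤ) =
          2 * a - l - 2 - q.1 - m by ring, show 2 * (a + b - (l + m) - 1) - r - (h + k - m) - 2 =
          2 * a + 2 * b - 2 * l - 4 - k - h - q.1 - p.2 - ((m + q.2 : ℕ) : ℤ) by omega]
    rw [Finset.sum_congr rfl hr, sum_range_sum_antidiagonal (f := fun s j =>
      ∑ q ∈ Finset.HasAntidiagonal.antidiagonal s, F q.1 q.2 j), Finset.sum_comm]
    · refine (Finset.sum_congr rfl fun j _ => sum_range_sum_antidiagonal (N := N)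
        (f := fun i n => F i n j)
        fun i n hin => hF i n j (by omega)).trans ?_
      rw [Finset.sum_comm]
    · intro s j hs
      refine Finset.sum_eq_zero fun q hq => hF _ _ _ ?_
      have hq' := Finset.HasAntidiagonal.mem_antidiagonal.1 hq
      omega
  rw [binExp_eq_sum (N := N) fun m hm => by simp only [hzero m hm, Ystar_zero]; rfl]
  simp only [hstar, Finset.smul_sum]
  rw [Finset.sum_comm]
  refine Finset.sum_congr rfl fun i _ => ?_
  rw [Finset.sum_comm]
  refine Finset.sum_congr rfl fun j _ => ?_
  rw [← sum_range_sum_antidiagonal (f := fun m n => ((1 : ℂ) ^ m * bc k m) •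
    ((-1 : ℂ) ^ (a + b - l - 1) * ((-1) ^ m * bc (2 * a - l - 2 - i - m) n)) • G i j (m + n))]
  · refine Finset.sum_congr rfl fun I _ => ?_
    -- For fixed `I = m + n` the vector `G i j I` is constant, and the binomials from the iterate
    -- and from the conjugation by `e^{L(1)}` collapse to one.
    rw [← sum_antidiagonal_bc_mul_bc, Finset.sum_smul, Finset.smul_sum]
    refine Finset.sum_congr rfl fun p hp => ?_
    rw [Finset.HasAntidiagonal.mem_antidiagonal.1 hp, smul_smul, smul_smul]
    congr 1
    ring
  · intro m n hmn
    simp only [hG i j (m + n) (by omega), smul_zero]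

/-- The products in the opposite Jacobi identity, for homogeneous vectors. -/
theorem binExp_Ystar_Ystar {a b : ℤ} {u v : V} (hu : u ∈ A.grade a) (hv : v ∈ A.grade b) (l : ℤ)
    {N : ℕ} (huN : ∀ r, N ≤ r → A.divL1 r u = 0) (hvN : ∀ r, N ≤ r → A.divL1 r v = 0) (k h : ℤ)
    (w : W) :
    binExp (-1) l (fun k h => M.Ystar v h (M.Ystar u k w)) k h =
      ∑ i ∈ Finset.range N, ∑ j ∈ Finset.range N, (-1 : ℂ) ^ (a + b) •
        binExp (-1) l (fun h k => M.Y (A.divL1 j v) h (M.Y (A.divL1 i u) k w))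
          (2 * b - j - 2 - h - l) (2 * a - i - 2 - k - l) := by
  have hT : ∀ i j : ℕ, Trunc fun k h => M.Y (A.divL1 j v) (2 * b - j - h - 2)
      (M.Y (A.divL1 i u) (2 * a - i - k - 2) w) := fun i j => by
    obtain ⟨N, hN⟩ := M.truncation (A.divL1 i u) w
    exact fun k h => ⟨(N - (2 * a - i - k - 2)).toNat, fun m hm => by
      simp only [hN (2 * a - i - (k - m) - 2) (by omega), map_zero]⟩
  have hexp : (fun k h => M.Ystar v h (M.Ystar u k w)) = fun k h =>
      ∑ i ∈ Finset.range N, ∑ j ∈ Finset.range N, (-1 : ℂ) ^ (a + b) •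
        M.Y (A.divL1 j v) (2 * b - j - h - 2) (M.Y (A.divL1 i u) (2 * a - i - k - 2) w) := by
    ext k h
    rw [M.Ystar_of_mem_grade hu huN, M.Ystar_of_mem_grade hv hvN]
    simp only [LinearMap.sum_apply, map_sum, LinearMap.smul_apply, map_smul]
    refine Finset.sum_congr rfl fun i _ => ?_
    rw [Finset.smul_sum]
    refine Finset.sum_congr rfl fun j _ => ?_
    rw [smul_smul, zpow_add₀ (by norm_num), mul_comm]
  rw [hexp, binExp_sum _ _ _ fun i _ => Trunc.sum _ fun j _ => (hT i j).smul _]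
  refine Finset.sum_congr rfl fun i _ => ?_
  rw [binExp_sum _ _ _ fun j _ => (hT i j).smul _]
  refine Finset.sum_congr rfl fun j _ => ?_
  rw [binExp_smul]
  congr 1
  refine binExp_congr fun m => ?_
  rw [show 2 * b - (j : ℤ) - 2 - h - l + l - m = 2 * b - j - (h + m) - 2 by ring,
    show 2 * a - (i : ℤ) - 2 - k - l + m = 2 * a - i - (k + l - m) - 2 by ring]

/-- With `y = x⁻¹`, the identity is a signed sum over `i, j` of ordinary Borcherds identities for
`L(1)^i u / i!` and `L(1)^j v / j!`. -/
theorem oppositeJacobiOn_of_mem_grade {a b : ℤ} {u v : V} (hu : u ∈ A.grade a)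
    (hv : v ∈ A.grade b) (w : W) : M.OppositeJacobiOn u v w := by
  intro l k h
  obtain ⟨N, huN, hvN, hN⟩ := A.exists_divL1_bound hu hv l
  rw [M.binExp_iterate_Ystar hu hv hN, M.binExp_Ystar_Ystar hu hv l huN hvN,
    M.binExp_Ystar_Ystar hv hu l hvN huN, Finset.sum_comm (s := Finset.range N)
      (f := fun j i => (-1 : ℂ) ^ (b + a) • binExp (-1) l
        (fun k h => M.Y (A.divL1 i u) k (M.Y (A.divL1 j v) h w)) (2 * a - i - 2 - k - l)
          (2 * b - j - 2 - h - l)), Finset.smul_sum, ← Finset.sum_sub_distrib]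
  refine Finset.sum_congr rfl fun i _ => ?_
  rw [Finset.smul_sum, ← Finset.sum_sub_distrib]
  refine Finset.sum_congr rfl fun j _ => ?_
  -- The extra `-l` in both exponents comes from `(x₁ - x₂)^l = (y₂ - y₁)^l (y₁ y₂)^{-l}`.
  have hJ := (M.jacobi (A.divL1 i u) (A.divL1 j v) w).modes l (2 * a - i - 2 - k - l)
    (2 * b - j - 2 - h - l)
  have hsq : (-1 : ℂ) ^ l * (-1) ^ l = 1 := by
    rw [← zpow_add₀ (by norm_num), ← two_mul, zpow_mul]; norm_num
  have hsign : (-1 : ℂ) ^ (a + b - l - 1) = -((-1) ^ (a + b) * (-1) ^ l) := by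
    rw [zpow_sub_one₀ (by norm_num), show a + b - l = a + b + -l by ring,
      zpow_add₀ (by norm_num) (a + b) (-l), neg_one_zpow_neg]
    norm_num
  have hR : binExp 1 (2 * a - i - 2 - k - l)
      (fun h m => M.Y (A.Y (A.divL1 i u) m (A.divL1 j v)) h w) (2 * b - j - 2 - h - l) l =
      ∑ I ∈ Finset.range N, bc (2 * a - l - 2 - i - k) I •
        M.Y (A.Y (A.divL1 i u) (l + I) (A.divL1 j v))
          (2 * a + 2 * b - 2 * l - 4 - k - h - i - j - I) w := by
    rw [binExp_eq_sum (N := N) fun m hm => by rw [hN i j m (by omega)]; simp]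
    refine Finset.sum_congr rfl fun I _ => ?_
    rw [one_pow, one_mul, show 2 * a - (i : ℤ) - 2 - k - l = 2 * a - l - 2 - i - k by ring,
      show 2 * b - (j : ℤ) - 2 - h - l + (2 * a - l - 2 - i - k) - I =
        2 * a + 2 * b - 2 * l - 4 - k - h - i - j - I by ring]
  have hmul : -((-1 : ℂ) ^ (a + b) * (-1) ^ l) * (-1) ^ l = -(-1) ^ (a + b) := by
    linear_combination -(-1 : ℂ) ^ (a + b) * hsq
  rw [← hR, ← hJ, hsign, smul_sub, add_comm b a]
  simp only [smul_smul, hmul]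
  module

theorem OppositeJacobiOn.add_left {M : VOAModule A W} {u u' v : V} {w : W}
    (h₁ : M.OppositeJacobiOn u v w) (h₂ : M.OppositeJacobiOn u' v w) :
    M.OppositeJacobiOn (u + u') v w := by
  intro l k h
  have e1 := binExp_add (-1) l (M.trunc_Ystar_Ystar u v w) (M.trunc_Ystar_Ystar u' v w) k h
  have e2 := binExp_add (-1) l (M.trunc_Ystar_Ystar v u w) (M.trunc_Ystar_Ystar v u' w) h k
  have e3 := binExp_add 1 k (M.trunc_iterate_Ystar u v w) (M.trunc_iterate_Ystar u' v w) h l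
  simp only [Ystar_add, LinearMap.add_apply, map_add, Pi.add_apply]
  rw [e1, e2, e3, ← h₁ l k h, ← h₂ l k h]
  module

theorem OppositeJacobiOn.add_right {M : VOAModule A W} {u v v' : V} {w : W}
    (h₁ : M.OppositeJacobiOn u v w) (h₂ : M.OppositeJacobiOn u v' w) :
    M.OppositeJacobiOn u (v + v') w := by
  intro l k h
  have e1 := binExp_add (-1) l (M.trunc_Ystar_Ystar u v w) (M.trunc_Ystar_Ystar u v' w) k h
  have e2 := binExp_add (-1) l (M.trunc_Ystar_Ystar v u w) (M.trunc_Ystar_Ystar v' u w) h k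
  have e3 := binExp_add 1 k (M.trunc_iterate_Ystar u v w) (M.trunc_iterate_Ystar u v' w) h l
  simp only [Ystar_add, LinearMap.add_apply, map_add]
  rw [e1, e2, e3, ← h₁ l k h, ← h₂ l k h]
  module

theorem _root_.QzTensor.VertexOperatorAlgebra.induction_grade (A : VertexOperatorAlgebra V)
    {p : V → Prop} (hmem : ∀ n, ∀ v ∈ A.grade n, p v) (hadd : ∀ u v, p u → p v → p (u + v))
    (v : V) : p v := by
  obtain ⟨s, hs⟩ := A.eq_sum_proj v
  rw [hs]
  exact Finset.sum_induction _ p hadd (hmem 0 0 (Submodule.zero_mem _))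
    fun n _ => hmem n _ (A.proj_mem n v)

theorem oppositeJacobiOn (u v : V) (w : W) : M.OppositeJacobiOn u v w :=
  A.induction_grade (p := fun u => M.OppositeJacobiOn u v w)
    (fun _ u hu => A.induction_grade (p := fun v => M.OppositeJacobiOn u v w)
      (fun _ _ hv => M.oppositeJacobiOn_of_mem_grade hu hv w)
      (fun _ _ => OppositeJacobiOn.add_right) v)
    (fun _ _ => OppositeJacobiOn.add_left) u

end VOAModule

/-! ## Passing from powers of `x` to powers of `x` and `x - z` -/

section Twist

variable {M : Type*} [AddCommGroup M] [Module ℂ M]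

theorem binExp_rec_right (c : ℂ) (l : ℤ) {z : ℂ} {P P' : ℤ → ℤ → M} (hP : Trunc P)
    (h : ∀ x y, P' x y = P x (y + 1) - z • P x y) (x y : ℤ) :
    binExp c l P' x y = binExp c l P x (y + 1) - z • binExp c l P x y := by
  have hs := hP.shift 0 1
  have hb := binExp_shift c l P 0 1 x y
  simp only [add_zero] at hs hb
  rw [← binExp_smul, ← hb, ← binExp_sub c l hs (hP.smul z)]
  exact binExp_congr fun i => h _ _

theorem binExp_rec_left (c : ℂ) (l : ℤ) {z : ℂ} {P P' : ℤ → ℤ → M} (hP : Trunc P)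
    (h : ∀ x y, P' x y = P (x + 1) y - z • P x y) (x y : ℤ) :
    binExp c l P' x y = binExp c l P (x + 1) y - z • binExp c l P x y := by
  have hs := hP.shift 1 0
  have hb := binExp_shift c l P 1 0 x y
  simp only [add_zero] at hs hb
  rw [← binExp_smul, ← hb, ← binExp_sub c l hs (hP.smul z)]
  exact binExp_congr fun i => h _ _

theorem eq_zero_of_eventually_atTop {z : ℂ} (hz : z ≠ 0) (Y : ℤ → M)
    (hY : ∀ k, Y (k + 1) = z • Y k) (h : ∀ᶠ k in Filter.atTop, Y k = 0) (k : ℤ) : Y k = 0 := by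
  obtain ⟨N, hN⟩ := Filter.eventually_atTop.1 h
  by_contra hk
  have key : ∀ i : ℕ, Y (k + i) ≠ 0 := fun i => by
    induction i with
    | zero => simpa using hk
    | succ i ih =>
      rw [Nat.cast_succ, ← add_assoc, hY]
      exact smul_ne_zero hz ih
  exact key (N - k).toNat (hN _ (by omega))

theorem eq_zero_of_eventually_atBot {z : ℂ} (Y : ℤ → M)
    (hY : ∀ k, Y (k + 1) = z • Y k) (h : ∀ᶠ k in Filter.atBot, Y k = 0) (k : ℤ) : Y k = 0 := by
  obtain ⟨N, hN⟩ := Filter.eventually_atBot.1 h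
  have key : ∀ i : ℕ, Y (N + i) = 0 := fun i => by
    induction i with
    | zero => simpa using hN N le_rfl
    | succ i ih => rw [Nat.cast_succ, ← add_assoc, hY, ih, smul_zero]
  rcases le_total k N with hk | hk
  · exact hN k hk
  · have := key (k - N).toNat
    rwa [show N + ((k - N).toNat : ℤ) = k by omega] at this

/-- Upward in `m` the recursion propagates zero. Downward, vanishing at `m + 1` makes `X m`
geometric in `k` with ratio `z`, and vanishing at one end then forces it to be zero. -/
theorem eq_zero_of_shift_rec {z : ℂ} {F : Filter ℤ}
    (hF : ∀ Y : ℤ → M, (∀ k, Y (k + 1) = z • Y k) → (∀ᶠ k in F, Y k = 0) → ∀ k, Y k = 0)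
    {X : ℤ → ℤ → M} (hX : ∀ m k, X (m + 1) k = X m (k + 1) - z • X m k) (h0 : ∀ k, X 0 k = 0)
    (hend : ∀ m, ∀ᶠ k in F, X m k = 0) (m k : ℤ) : X m k = 0 := by
  induction m using Int.induction_on generalizing k with
  | zero => exact h0 k
  | succ m ih => rw [hX, ih, ih, smul_zero, sub_zero]
  | pred m ih =>
    refine hF _ (fun k => ?_) (hend _) k
    have := hX (-m - 1) k
    rw [sub_add_cancel, ih] at this
    exact (sub_eq_zero.1 this.symm)

theorem eventually_forall_nat {κ : Type*} {F : Filter κ} {p : κ → ℕ → Prop} (N : ℕ)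
    (h₁ : ∀ i < N, ∀ᶠ x in F, p x i) (h₂ : ∀ᶠ x in F, ∀ i, N ≤ i → p x i) :
    ∀ᶠ x in F, ∀ i, p x i := by
  have h₁' : ∀ᶠ x in F, ∀ i ∈ Finset.range N, p x i :=
    (Filter.eventually_all_finset _).2 fun i hi => h₁ i (Finset.mem_range.1 hi)
  filter_upwards [h₁', h₂] with x hx₁ hx₂ i
  by_cases hi : i < N
  · exact hx₁ i (Finset.mem_range.2 hi)
  · exact hx₂ i (not_lt.1 hi)

/-- If Borcherds' identity holds for the values of `P₁`, `P₂`, `Q` on powers of `x₁` and `x₂`, then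
it holds for their values on powers of `x₁`, `x₁ - z`, `x₂` and `x₂ - z`; here `P₁ m k n h` is the
value on `(x₁ - z)^m x₁^k (x₂ - z)^n x₂^h` and `Q j n h` is the value of the `j`-th product on
`(x₂ - z)^n x₂^h`. -/
theorem borcherds_twist {z : ℂ} {F : Filter ℤ}
    (hF : ∀ Y : ℤ → M, (∀ k, Y (k + 1) = z • Y k) → (∀ᶠ k in F, Y k = 0) → ∀ k, Y k = 0)
    (hshift : ∀ a : ℤ, Filter.Tendsto (fun k => a + k) F F)
    {P₁ P₂ : ℤ → ℤ → ℤ → ℤ → M} {Q : ℤ → ℤ → ℤ → M}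
    (hT₁ : ∀ m n, Trunc fun k h => P₁ m k n h) (hT₂ : ∀ m n, Trunc fun h k => P₂ m k n h)
    (hTQ : ∃ J : ℤ, ∀ j ≥ J, ∀ n h, Q j n h = 0)
    (hm₁ : ∀ m k n h, P₁ (m + 1) k n h = P₁ m (k + 1) n h - z • P₁ m k n h)
    (hm₂ : ∀ m k n h, P₂ (m + 1) k n h = P₂ m (k + 1) n h - z • P₂ m k n h)
    (hn₁ : ∀ m k n h, P₁ m k (n + 1) h = P₁ m k n (h + 1) - z • P₁ m k n h)
    (hn₂ : ∀ m k n h, P₂ m k (n + 1) h = P₂ m k n (h + 1) - z • P₂ m k n h)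
    (hQ : ∀ j n h, Q j (n + 1) h = Q j n (h + 1) - z • Q j n h)
    (hk₁ : ∀ l m n h, ∀ᶠ k in F, ∀ i : ℕ, P₁ m (k + l - i) n (h + i) = 0)
    (hk₂ : ∀ l m n h, ∀ᶠ k in F, ∀ i : ℕ, P₂ m (k + i) n (h + l - i) = 0)
    (hh₁ : ∀ l m k n, ∀ᶠ h in F, ∀ i : ℕ, P₁ m (k + l - i) n (h + i) = 0)
    (hh₂ : ∀ l m k n, ∀ᶠ h in F, ∀ i : ℕ, P₂ m (k + i) n (h + l - i) = 0)
    (hhQ : ∀ j n, ∀ᶠ h in F, Q j n h = 0)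
    (hbase : ∀ l k h : ℤ, binExp (-1) l (fun k h => P₁ 0 k 0 h) k h -
        (-1 : ℂ) ^ l • binExp (-1) l (fun h k => P₂ 0 k 0 h) h k =
      binExp 1 k (fun h j => Q j 0 h) h l) (l m k n h : ℤ) :
    binExp (-1) l (fun k h => P₁ m k n h) k h -
        (-1 : ℂ) ^ l • binExp (-1) l (fun h k => P₂ m k n h) h k =
      binExp 1 m (fun n j => binExp 1 k (fun h j => Q j n h) h j) n l := by
  obtain ⟨J, hJ⟩ := hTQ
  have hTQ : ∀ n, Trunc fun h j => Q j n h := fun n h j =>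
    ⟨(J - j).toNat, fun i hi => hJ _ (by omega) _ _⟩
  set I : ℤ → ℤ → ℤ → ℤ → M := fun n k h j => binExp 1 k (fun h j => Q j n h) h j with hI
  have hIn : ∀ n k h j, I (n + 1) k h j = I n k (h + 1) j - z • I n k h j := fun n k h j =>
    binExp_rec_left 1 k (hTQ n) (fun h j => hQ j n h) h j
  have hIk : ∀ n k h j, I n (k + 1) h j = I n k (h + 1) j + I n k h (j + 1) := fun n k h j => by
    simp only [hI]
    rw [binExp_succ _ _ (hTQ n), one_smul]
  have hTI : ∀ k h, Trunc fun n j => I n k h j := fun k h n j =>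
    ⟨(J - j).toNat, fun i hi => binExp_eq_zero fun i' => hJ _ (by omega) _ _⟩
  -- The iterate side paired with `x₀^l (x₂ - z + x₀)^m (x₂ + x₀)^k (x₂ - z)^n x₂^h`, where `x₁ = x₂
  -- + x₀`.
  set O : ℤ → ℤ → ℤ → ℤ → ℤ → M := fun l m k n h => binExp 1 m (fun n j => I n k h j) n l with hO
  have hOn : ∀ l m k n h, O l m k (n + 1) h = O l m k n (h + 1) - z • O l m k n h := by
    intro l m k n h
    have hb := binExp_shift 1 m (fun n j => I n k h j) 1 0 n l
    simp only [add_zero] at hb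
    simp only [hO]
    rw [← hb, ← binExp_smul, ← binExp_sub 1 m (hTI k (h + 1)) ((hTI k h).smul z)]
    simp only [hIn]
  have hOk : ∀ l m k n h, O l m (k + 1) n h = O l m k n (h + 1) + O (l + 1) m k n h := by
    intro l m k n h
    have hb := binExp_shift 1 m (fun n j => I n k h j) 0 1 n l
    have hs := (hTI k h).shift 0 1
    simp only [add_zero] at hb hs
    simp only [hO]
    rw [← hb, ← binExp_add 1 m (hTI k (h + 1)) hs]
    simp only [hIk]
  have hOm : ∀ l m k n h, O l (m + 1) k n h = O l m (k + 1) n h - z • O l m k n h := by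
    intro l m k n h
    have : O l (m + 1) k n h = O l m k (n + 1) h + O (l + 1) m k n h := by
      simp only [hO]
      rw [binExp_succ _ _ (hTI k h), one_smul]
    rw [this, hOn, hOk]
    abel
  -- the three sides vanish at the end
  have hO0 : ∀ {κ : Type} {G : Filter κ} {l m : ℤ} {k n h : κ → ℤ} (_ : ∀ i i' : ℕ,
      ∀ᶠ x in G, Q (l + i + i') (n x + m - i) (h x + k x - i') = 0),
      ∀ᶠ x in G, O l m (k x) (n x) (h x) = 0 := by
    intro κ G l m k n h hx
    -- Truncation in `j` leaves finitely many pairs `(i, i')` to control.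
    have : ∀ᶠ x in G, ∀ i i' : ℕ, Q (l + i + i') (n x + m - i) (h x + k x - i') = 0 := by
      refine eventually_forall_nat (J - l).toNat (fun i _ => ?_) (Filter.Eventually.of_forall
        fun x i hi i' => hJ _ (by omega) _ _)
      exact eventually_forall_nat (J - l).toNat (fun i' _ => hx i i') (Filter.Eventually.of_forall
        fun x i' hi => hJ _ (by omega) _ _)
    filter_upwards [this] with x hx
    exact binExp_eq_zero fun i => binExp_eq_zero fun i' => hx i i'
  set X : ℤ → ℤ → ℤ → ℤ → ℤ → M := fun l m k n h =>
    binExp (-1) l (fun k h => P₁ m k n h) k h -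
      (-1 : ℂ) ^ l • binExp (-1) l (fun h k => P₂ m k n h) h k - O l m k n h with hXdef
  suffices hX : X l m k n h = 0 from sub_eq_zero.1 hX
  -- The exponent `n` of `x₂ - z` is treated first, at `m = 0`; the exponent `m` of `x₁ - z`
  -- follows, starting from this case.
  have hX0 : ∀ l k n h, X l 0 k n h = 0 := by
    intro l k
    refine eq_zero_of_shift_rec hF (fun n h => ?_) (fun h => ?_) (fun n => ?_)
    · simp only [hXdef]
      rw [binExp_rec_right _ l (hT₁ 0 n) (fun k h => hn₁ 0 k n h),
        binExp_rec_left _ l (hT₂ 0 n) (fun h k => hn₂ 0 k n h), hOn]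
      module
    · simp only [hXdef, hO, hI, binExp_zero]
      rw [hbase, sub_self]
    · have hQh := hO0 (G := F) (l := l) (m := 0) (k := fun _ => k) (n := fun _ => n)
        (h := fun h => h) fun i i' => by
          have := (hshift (k - i')).eventually (hhQ (l + i + i') (n + 0 - i))
          filter_upwards [this] with h hh
          rw [← hh]
          congr 1
          ring
      filter_upwards [hh₁ l 0 k n, hh₂ l 0 k n, hQh] with h h1 h2 h3
      simp only [hXdef]
      rw [binExp_eq_zero h1, binExp_eq_zero h2, h3, smul_zero, sub_zero, sub_zero]
  refine eq_zero_of_shift_rec hF (X := fun m k => X l m k n h) (fun m k => ?_)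
    (fun k => hX0 l k n h) (fun m => ?_) m k
  · simp only [hXdef]
    rw [binExp_rec_left _ l (hT₁ m n) (fun k h => hm₁ m k n h),
      binExp_rec_right _ l (hT₂ m n) (fun h k => hm₂ m k n h), hOm]
    module
  · have hQk := hO0 (G := F) (l := l) (m := m) (k := fun k => k) (n := fun _ => n)
      (h := fun _ => h) fun i i' => by
        have := (hshift (h - i')).eventually (hhQ (l + i + i') (n + m - i))
        filter_upwards [this] with k hk
        rw [← hk]
        congr 1
        ring
    filter_upwards [hk₁ l m n h, hk₂ l m n h, hQk] with k h1 h2 h3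
    simp only [hXdef]
    rw [binExp_eq_zero h1, binExp_eq_zero h2, h3, smul_zero, sub_zero, sub_zero]

end Twist

/-! ### Vanishing of products of modes at the ends -/

section Ends

variable {M : Type*} [AddCommGroup M]

theorem eventually_atBot_fst {R : ℤ → ℤ → M} (h₁ : ∃ N : ℤ, ∀ x ≤ N, ∀ y, R x y = 0) (x₀ y₀ : ℤ) :
    ∀ᶠ x in Filter.atBot, ∀ i : ℕ, R (x + x₀ - i) (y₀ + i) = 0 := by
  obtain ⟨N, hN⟩ := h₁
  filter_upwards [Filter.eventually_le_atBot (N - x₀)] with x hx i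
  exact hN _ (by omega) _

theorem eventually_atBot_snd {R : ℤ → ℤ → M} (h₁ : ∃ N : ℤ, ∀ x ≤ N, ∀ y, R x y = 0)
    (h₂ : ∀ x, ∃ N : ℤ, ∀ y ≤ N, R x y = 0) (x₀ : ℤ) :
    ∀ᶠ y in Filter.atBot, ∀ i : ℕ, R (x₀ - i) (y + i) = 0 := by
  obtain ⟨N, hN⟩ := h₁
  refine eventually_forall_nat (x₀ - N).toNat (fun i _ => ?_)
    (Filter.Eventually.of_forall fun y i hi => hN _ (by omega) _)
  obtain ⟨N', hN'⟩ := h₂ (x₀ - i)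
  filter_upwards [Filter.eventually_le_atBot (N' - i)] with y hy
  exact hN' _ (by omega)

theorem eventually_atTop_fst {R : ℤ → ℤ → M} (h₁ : ∃ N : ℤ, ∀ x ≥ N, ∀ y, R x y = 0) (y₀ : ℤ) :
    ∀ᶠ x in Filter.atTop, ∀ i : ℕ, R (x + i) (y₀ - i) = 0 := by
  obtain ⟨N, hN⟩ := h₁
  filter_upwards [Filter.eventually_ge_atTop N] with x hx i
  exact hN _ (by omega) _

theorem eventually_atTop_snd {R : ℤ → ℤ → M} (h₁ : ∃ N : ℤ, ∀ x ≥ N, ∀ y, R x y = 0)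
    (h₂ : ∀ x, ∃ N : ℤ, ∀ y ≥ N, R x y = 0) (x₀ y₀ : ℤ) :
    ∀ᶠ y in Filter.atTop, ∀ i : ℕ, R (x₀ + i) (y + y₀ - i) = 0 := by
  obtain ⟨N, hN⟩ := h₁
  refine eventually_forall_nat (N - x₀).toNat (fun i _ => ?_)
    (Filter.Eventually.of_forall fun y i hi => hN _ (by omega) _)
  obtain ⟨N', hN'⟩ := h₂ (x₀ + i)
  filter_upwards [Filter.eventually_ge_atTop (N' - y₀ + i)] with y hy
  exact hN' _ (by omega)

end Ends

/-! ### Borcherds' identity for the modes on each tensor factor -/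

section Action

variable {V : Type*} [AddCommGroup V] [Module ℂ V] {A : VertexOperatorAlgebra V}
  {W₁ : Type*} [AddCommGroup W₁] [Module ℂ W₁] {W₂ : Type*} [AddCommGroup W₂] [Module ℂ W₂]

theorem starMode_zero_vec (M₁ : VOAModule A W₁) (z : ℂ) (n k : ℤ) : starMode M₁ z 0 n k = 0 := by
  ext w
  rw [starMode_apply]
  exact binExp_eq_zero fun i => by rw [M₁.Ystar_zero]; rfl

theorem plusMode_zero_vec (M₂ : VOAModule A W₂) (z : ℂ) (n k : ℤ) : plusMode M₂ z 0 n k = 0 := by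
  ext w
  rw [plusMode_apply]
  exact binExp_eq_zero fun i => by simp

theorem tauMode_zero_vec (M₁ : VOAModule A W₁) (M₂ : VOAModule A W₂) (z : ℂ) (n k : ℤ) :
    tauMode M₁ M₂ z 0 n k = 0 := by
  refine LinearMap.ext fun lam => TensorProduct.ext' fun w₁ w₂ => ?_
  simp [tauMode_apply_tmul, starMode_zero_vec, plusMode_zero_vec]

theorem trunc_starMode (M₁ : VOAModule A W₁) (z : ℂ) (v : V) (n : ℤ) (w : W₁) {N : Type*}
    [AddCommGroup N] [Module ℂ N] (f : ℤ → W₁ →ₗ[ℂ] N) :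
    Trunc fun k h => f h (starMode M₁ z v n k w) := by
  obtain ⟨N, hN⟩ := starMode_truncation M₁ z v n w
  exact fun k h => ⟨(k - N).toNat, fun i hi => by simp only [hN (k - i) (by omega), map_zero]⟩

theorem trunc_plusMode (M₂ : VOAModule A W₂) (z : ℂ) (v : V) (n : ℤ) (w : W₂) {N : Type*}
    [AddCommGroup N] [Module ℂ N] (f : ℤ → W₂ →ₗ[ℂ] N) :
    Trunc fun h k => f h (plusMode M₂ z v n k w) := by
  obtain ⟨N, hN⟩ := plusMode_truncation M₂ z v n w
  exact fun k h => ⟨(N - h).toNat, fun i hi => by simp only [hN (h + i) (by omega), map_zero]⟩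

/-- `borcherds_twist` is applied at `atBot`, since the modes of `Y₁*` vanish for small index. -/
theorem starMode_borcherds (M₁ : VOAModule A W₁) (z : ℂ) (u v : V) (w : W₁) (l m k n h : ℤ) :
    binExp (-1) l (fun k h => starMode M₁ z v n h (starMode M₁ z u m k w)) k h -
        (-1 : ℂ) ^ l • binExp (-1) l (fun h k => starMode M₁ z u m k (starMode M₁ z v n h w)) h k =
      binExp 1 m (fun n j =>
        binExp 1 k (fun h j => starMode M₁ z (A.Y u j v) n h w) h j) n l := by
  have hend : ∀ (u v : V) (m n : ℤ),
      ∃ N : ℤ, ∀ x ≤ N, ∀ y, starMode M₁ z v n y (starMode M₁ z u m x w) = 0 := fun u v m n => by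
    obtain ⟨N, hN⟩ := starMode_truncation M₁ z u m w
    exact ⟨N, fun x hx y => by rw [hN x hx, map_zero]⟩
  have hend' : ∀ (u v : V) (m n x : ℤ),
      ∃ N : ℤ, ∀ y ≤ N, starMode M₁ z v n y (starMode M₁ z u m x w) = 0 := fun u v m n x =>
    starMode_truncation M₁ z v n _
  refine borcherds_twist (z := z) (F := Filter.atBot)
    (P₁ := fun m k n h => starMode M₁ z v n h (starMode M₁ z u m k w))
    (P₂ := fun m k n h => starMode M₁ z u m k (starMode M₁ z v n h w))
    (Q := fun j n h => starMode M₁ z (A.Y u j v) n h w)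
    eq_zero_of_eventually_atBot (fun a => Filter.tendsto_atBot_add_const_left _ a Filter.tendsto_id)
    (fun m n => trunc_starMode M₁ z u m w _) (fun m n => trunc_starMode M₁ z v n w _)
    ?_ ?_ ?_ ?_ ?_ ?_
    (fun l m n h => eventually_atBot_fst (hend u v m n) l h)
    (fun l m n h => eventually_atBot_snd (hend v u n m) (hend' v u n m) (h + l))
    (fun l m k n => eventually_atBot_snd (hend u v m n) (hend' u v m n) (k + l))
    (fun l m k n => eventually_atBot_fst (hend v u n m) l k)
    ?_ ?_ l m k n h
  · obtain ⟨J, hJ⟩ := A.truncation u v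
    exact ⟨J, fun j hj n h => by rw [hJ j hj, starMode_zero_vec]; rfl⟩
  · intros; simp only [starMode_succ, LinearMap.sub_apply, LinearMap.smul_apply, map_sub, map_smul]
  · intros; simp only [starMode_succ, LinearMap.sub_apply, LinearMap.smul_apply]
  · intros; simp only [starMode_succ, LinearMap.sub_apply, LinearMap.smul_apply]
  · intros; simp only [starMode_succ, LinearMap.sub_apply, LinearMap.smul_apply, map_sub, map_smul]
  · intros; simp only [starMode_succ, LinearMap.sub_apply, LinearMap.smul_apply]
  · intro j n
    obtain ⟨N, hN⟩ := starMode_truncation M₁ z (A.Y u j v) n w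
    exact Filter.eventually_atBot.2 ⟨N, hN⟩
  · intro l k h
    simp only [starMode_zero]
    exact M₁.oppositeJacobiOn u v w l k h

/-- `borcherds_twist` is applied at `atTop`, since the modes of `Y₂` vanish for large index; a
geometric sequence is determined by that end only because `z ≠ 0`. -/
theorem plusMode_borcherds (M₂ : VOAModule A W₂) {z : ℂ} (hz : z ≠ 0) (u v : V) (w : W₂)
    (l m k n h : ℤ) :
    binExp (-1) l (fun k h => plusMode M₂ z u m k (plusMode M₂ z v n h w)) k h -
        (-1 : ℂ) ^ l • binExp (-1) l (fun h k => plusMode M₂ z v n h (plusMode M₂ z u m k w)) h k =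
      binExp 1 m (fun n j =>
        binExp 1 k (fun h j => plusMode M₂ z (A.Y u j v) n h w) h j) n l := by
  have hend : ∀ (u v : V) (m n : ℤ),
      ∃ N : ℤ, ∀ x ≥ N, ∀ y, plusMode M₂ z v n y (plusMode M₂ z u m x w) = 0 := fun u v m n => by
    obtain ⟨N, hN⟩ := plusMode_truncation M₂ z u m w
    exact ⟨N, fun x hx y => by rw [hN x hx, map_zero]⟩
  have hend' : ∀ (u v : V) (m n x : ℤ),
      ∃ N : ℤ, ∀ y ≥ N, plusMode M₂ z v n y (plusMode M₂ z u m x w) = 0 := fun u v m n x =>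
    plusMode_truncation M₂ z v n _
  refine borcherds_twist (z := z) (F := Filter.atTop)
    (P₁ := fun m k n h => plusMode M₂ z u m k (plusMode M₂ z v n h w))
    (P₂ := fun m k n h => plusMode M₂ z v n h (plusMode M₂ z u m k w))
    (Q := fun j n h => plusMode M₂ z (A.Y u j v) n h w)
    (eq_zero_of_eventually_atTop hz)
    (fun a => Filter.tendsto_atTop_add_const_left _ a Filter.tendsto_id)
    (fun m n => trunc_plusMode M₂ z v n w _) (fun m n => trunc_plusMode M₂ z u m w _)
    ?_ ?_ ?_ ?_ ?_ ?_
    (fun l m n h => eventually_atTop_snd (hend v u n m) (hend' v u n m) h l)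
    (fun l m n h => eventually_atTop_fst (hend u v m n) (h + l))
    (fun l m k n => eventually_atTop_fst (hend v u n m) (k + l))
    (fun l m k n => eventually_atTop_snd (hend u v m n) (hend' u v m n) k l)
    ?_ ?_ l m k n h
  · obtain ⟨J, hJ⟩ := A.truncation u v
    exact ⟨J, fun j hj n h => by rw [hJ j hj, plusMode_zero_vec]; rfl⟩
  · intros; simp only [plusMode_succ M₂ hz, LinearMap.sub_apply, LinearMap.smul_apply]
  · intros
    simp only [plusMode_succ M₂ hz, LinearMap.sub_apply, LinearMap.smul_apply, map_sub, map_smul]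
  · intros
    simp only [plusMode_succ M₂ hz, LinearMap.sub_apply, LinearMap.smul_apply, map_sub, map_smul]
  · intros; simp only [plusMode_succ M₂ hz, LinearMap.sub_apply, LinearMap.smul_apply]
  · intros; simp only [plusMode_succ M₂ hz, LinearMap.sub_apply, LinearMap.smul_apply]
  · intro j n
    obtain ⟨N, hN⟩ := plusMode_truncation M₂ z (A.Y u j v) n w
    exact Filter.eventually_atTop.2 ⟨N, hN⟩
  · intro l k h
    simp only [plusMode_zero]
    exact (M₂.jacobi u v w).modes l k h

end Action

/-! ## Products of two actions on a compatible functional -/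

/-- For negative `l`, vanishing at `l + 1` makes `D l` constant along the lines `m + n = const`;
moving along such a line reaches `n ≥ N`. The bound must not depend on `m`. -/
theorem eq_zero_of_pascal {M : Type*} [AddCommGroup M] {D : ℤ → ℤ → ℤ → M}
    (hD : ∀ l m n, D (l + 1) m n = D l (m + 1) n - D l m (n + 1)) (h0 : ∀ m n, D 0 m n = 0)
    (hN : ∃ N : ℤ, ∀ n ≥ N, ∀ l m, D l m n = 0) (l m n : ℤ) : D l m n = 0 := by
  obtain ⟨N, hN⟩ := hN
  induction l using Int.induction_on generalizing m n with
  | zero => exact h0 m n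
  | succ l ih => rw [hD, ih, ih, sub_zero]
  | pred l ih =>
    have hstep : ∀ m n, D (-l - 1) m n = D (-l - 1) (m - 1) (n + 1) := fun m n => by
      have := hD (-l - 1) (m - 1) n
      rw [sub_add_cancel, sub_add_cancel, ih] at this
      exact sub_eq_zero.1 this.symm
    have hiter : ∀ r : ℕ, D (-l - 1) m n = D (-l - 1) (m - r) (n + r) := fun r => by
      induction r with
      | zero => simp
      | succ r ih =>
        rw [ih, hstep]
        congr 1 <;> push_cast <;> ring
    rw [hiter (N - n).toNat]
    exact hN _ (by omega) _ _

theorem VertexOperatorAlgebra.trunc_of_truncation {V W : Type*} [AddCommGroup V] [Module ℂ V]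
    [AddCommGroup W] (A : VertexOperatorAlgebra V) {f : V → ℤ → W} (hf : ∀ n, f 0 n = 0)
    (u v : V) : Trunc fun n j => f (A.Y u j v) n := by
  obtain ⟨J, hJ⟩ := A.truncation u v
  exact fun k h => ⟨(J - h).toNat, fun i hi => by simp only [hJ (h + i) (by omega), hf]⟩

section Action

variable {V : Type*} [AddCommGroup V] [Module ℂ V] {A : VertexOperatorAlgebra V}
  {W₁ : Type*} [AddCommGroup W₁] [Module ℂ W₁] {W₂ : Type*} [AddCommGroup W₂] [Module ℂ W₂]
  (M₁ : VOAModule A W₁) (M₂ : VOAModule A W₂)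

/-- The action on `lam`, evaluated at `w₁ ⊗ w₂`, of
`(u ⊗ v) (x₁ - x₂)^l (x₁ - z)^m x₁^k (x₂ - z)^n x₂^h`, where `(x₁ - x₂)^l` is expanded according
to the order of the operators. -/
def tauProd (z : ℂ) (u v : V) (lam : Module.Dual ℂ (W₁ ⊗[ℂ] W₂)) (w₁ : W₁) (w₂ : W₂)
    (l m k n h : ℤ) : ℂ :=
  binExp (-1) l (fun k h => tauMode M₁ M₂ z v n h lam (starMode M₁ z u m k w₁ ⊗ₜ w₂)) k h -
    (-1 : ℂ) ^ l •
      binExp (-1) l (fun h k => tauMode M₁ M₂ z v n h lam (w₁ ⊗ₜ plusMode M₂ z u m k w₂)) h k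

variable {M₁ M₂}
variable {z : ℂ} {u v : V} {lam : Module.Dual ℂ (W₁ ⊗[ℂ] W₂)} {w₁ : W₁} {w₂ : W₂}

theorem trunc_star_tmul (f : ℤ → Module.Dual ℂ (W₁ ⊗[ℂ] W₂)) (m : ℤ) :
    Trunc fun k h => f h (starMode M₁ z u m k w₁ ⊗ₜ w₂) :=
  trunc_starMode M₁ z u m w₁ fun h => f h ∘ₗ (TensorProduct.mk ℂ W₁ W₂).flip w₂

theorem trunc_tmul_plus (f : ℤ → Module.Dual ℂ (W₁ ⊗[ℂ] W₂)) (m : ℤ) :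
    Trunc fun h k => f h (w₁ ⊗ₜ plusMode M₂ z u m k w₂) :=
  trunc_plusMode M₂ z u m w₂ fun h => f h ∘ₗ TensorProduct.mk ℂ W₁ W₂ w₁

theorem tauProd_succ_l (l m k n h : ℤ) : tauProd M₁ M₂ z u v lam w₁ w₂ (l + 1) m k n h =
    tauProd M₁ M₂ z u v lam w₁ w₂ l m (k + 1) n h -
      tauProd M₁ M₂ z u v lam w₁ w₂ l m k n (h + 1) := by
  simp only [tauProd]
  rw [binExp_succ _ _ (trunc_star_tmul (fun h => tauMode M₁ M₂ z v n h lam) m),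
    binExp_succ _ _ (trunc_tmul_plus (fun h => tauMode M₁ M₂ z v n h lam) m),
    zpow_add_one₀ (by norm_num)]
  module

theorem tauProd_succ_m (hz : z ≠ 0) (l m k n h : ℤ) :
    tauProd M₁ M₂ z u v lam w₁ w₂ l (m + 1) k n h =
      tauProd M₁ M₂ z u v lam w₁ w₂ l m (k + 1) n h -
        z • tauProd M₁ M₂ z u v lam w₁ w₂ l m k n h := by
  have hT₁ : Trunc fun k h => tauMode M₁ M₂ z v n h lam (starMode M₁ z u m k w₁ ⊗ₜ[ℂ] w₂) :=
    trunc_star_tmul _ m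
  have hT₂ : Trunc fun h k => tauMode M₁ M₂ z v n h lam (w₁ ⊗ₜ[ℂ] plusMode M₂ z u m k w₂) :=
    trunc_tmul_plus _ m
  simp only [tauProd]
  have h₁ := binExp_rec_left (-1) l (z := z) hT₁
    (P' := fun k h => tauMode M₁ M₂ z v n h lam (starMode M₁ z u (m + 1) k w₁ ⊗ₜ[ℂ] w₂))
    (fun k h => by simp only [starMode_succ, LinearMap.sub_apply, LinearMap.smul_apply,
      TensorProduct.sub_tmul, ← TensorProduct.smul_tmul', map_sub, map_smul]) k h
  have h₂ := binExp_rec_right (-1) l (z := z) hT₂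
    (P' := fun h k => tauMode M₁ M₂ z v n h lam (w₁ ⊗ₜ[ℂ] plusMode M₂ z u (m + 1) k w₂))
    (fun h k => by simp only [plusMode_succ M₂ hz, LinearMap.sub_apply, LinearMap.smul_apply,
      TensorProduct.tmul_sub, TensorProduct.tmul_smul, map_sub, map_smul]) h k
  rw [h₁, h₂]
  module

theorem tauProd_succ_n (hz : z ≠ 0) (l m k n h : ℤ) :
    tauProd M₁ M₂ z u v lam w₁ w₂ l m k (n + 1) h =
      tauProd M₁ M₂ z u v lam w₁ w₂ l m k n (h + 1) -
        z • tauProd M₁ M₂ z u v lam w₁ w₂ l m k n h := by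
  have hT₁ : Trunc fun k h => tauMode M₁ M₂ z v n h lam (starMode M₁ z u m k w₁ ⊗ₜ[ℂ] w₂) :=
    trunc_star_tmul _ m
  have hT₂ : Trunc fun h k => tauMode M₁ M₂ z v n h lam (w₁ ⊗ₜ[ℂ] plusMode M₂ z u m k w₂) :=
    trunc_tmul_plus _ m
  simp only [tauProd]
  have h₁ := binExp_rec_right (-1) l (z := z) hT₁
    (P' := fun k h => tauMode M₁ M₂ z v (n + 1) h lam (starMode M₁ z u m k w₁ ⊗ₜ[ℂ] w₂))
    (fun k h => by simp only [tauMode_succ M₁ M₂ hz, LinearMap.sub_apply, LinearMap.smul_apply]) k h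
  have h₂ := binExp_rec_left (-1) l (z := z) hT₂
    (P' := fun h k => tauMode M₁ M₂ z v (n + 1) h lam (w₁ ⊗ₜ[ℂ] plusMode M₂ z u m k w₂))
    (fun h k => by simp only [tauMode_succ M₁ M₂ hz, LinearMap.sub_apply, LinearMap.smul_apply]) h k
  rw [h₁, h₂]
  module

theorem tauProd_zero (m k n h : ℤ) : tauProd M₁ M₂ z u v lam w₁ w₂ 0 m k n h =
    tauMode M₁ M₂ z u m k (tauMode M₁ M₂ z v n h lam) (w₁ ⊗ₜ w₂) := by
  rw [tauProd, binExp_zero, binExp_zero, zpow_zero, one_smul, ← tauMode_apply_tmul]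

theorem Compatible.trunc_tauMode (hlam : Compatible M₁ M₂ z lam) (u v : V) :
    Trunc fun m n => tauMode M₁ M₂ z u m 0 (tauMode M₁ M₂ z v n 0 lam) := by
  obtain ⟨N, hN⟩ := hlam.tauMode_truncation v
  exact fun k h => ⟨(N - h).toNat, fun i hi => by
    simp only [hN (h + i) (by omega), map_zero]⟩

/-- On a compatible functional the product of the two actions may be computed by expanding
`(x₁ - x₂)^l` at `x₂ = z`. -/
theorem Compatible.tauProd_eq (hlam : Compatible M₁ M₂ z lam) (hz : z ≠ 0) (u v : V) (w₁ : W₁)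
    (w₂ : W₂) (l m n : ℤ) : tauProd M₁ M₂ z u v lam w₁ w₂ l m 0 n 0 =
      binExp (-1) l (fun m n => tauMode M₁ M₂ z u m 0 (tauMode M₁ M₂ z v n 0 lam)) m n
        (w₁ ⊗ₜ w₂) := by
  have hT := hlam.trunc_tauMode u v
  obtain ⟨N, hN⟩ := hlam.tauMode_truncation v
  refine sub_eq_zero.1 (eq_zero_of_pascal (D := fun l m n =>
    tauProd M₁ M₂ z u v lam w₁ w₂ l m 0 n 0 - binExp (-1) l
      (fun m n => tauMode M₁ M₂ z u m 0 (tauMode M₁ M₂ z v n 0 lam)) m n (w₁ ⊗ₜ w₂))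
    (fun l m n => ?_) (fun m n => ?_) ⟨N, fun n hn l m => ?_⟩ l m n)
  -- The recursion for `tauProd` uses `x₁ - x₂`, the other one `(x₁ - z) - (x₂ - z)`; the two
  -- multiples of `z` cancel.
  · rw [tauProd_succ_l, binExp_succ _ _ hT, tauProd_succ_m hz, tauProd_succ_n hz]
    simp only [LinearMap.add_apply, LinearMap.smul_apply]
    module
  · rw [tauProd_zero, binExp_zero, sub_self]
  · simp only [tauProd]
    rw [binExp_eq_zero fun i => ?_, binExp_eq_zero fun i => ?_, binExp_eq_zero fun i => ?_]
    · simp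
    · rw [hN _ (by omega), map_zero]
    · rw [hN n hn, LinearMap.zero_apply]
    · rw [hN n hn, LinearMap.zero_apply]

/-- Separates the terms with both operators on one tensor factor, to which Borcherds' identity
applies, from the mixed ones. -/
theorem tauProd_expand (l m k n h : ℤ) : tauProd M₁ M₂ z u v lam w₁ w₂ l m k n h =
    (binExp (-1) l (fun k h => lam (starMode M₁ z v n h (starMode M₁ z u m k w₁) ⊗ₜ w₂)) k h -
      binExp (-1) l (fun k h => lam (starMode M₁ z u m k w₁ ⊗ₜ plusMode M₂ z v n h w₂)) k h) -
    (-1 : ℂ) ^ l •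
      (binExp (-1) l (fun h k => lam (starMode M₁ z v n h w₁ ⊗ₜ plusMode M₂ z u m k w₂)) h k -
      binExp (-1) l (fun h k => lam (w₁ ⊗ₜ plusMode M₂ z v n h (plusMode M₂ z u m k w₂))) h k) := by
  simp only [tauProd, tauMode_apply_tmul]
  rw [binExp_sub, binExp_sub]
  · exact trunc_plusMode M₂ z u m w₂ fun h =>
      lam ∘ₗ TensorProduct.mk ℂ W₁ W₂ (starMode M₁ z v n h w₁)
  · exact trunc_plusMode M₂ z u m w₂ fun h =>
      lam ∘ₗ TensorProduct.mk ℂ W₁ W₂ w₁ ∘ₗ plusMode M₂ z v n h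
  · exact trunc_starMode M₁ z u m w₁ fun h =>
      lam ∘ₗ (TensorProduct.mk ℂ W₁ W₂).flip w₂ ∘ₗ starMode M₁ z v n h
  · exact trunc_starMode M₁ z u m w₁ fun h =>
      lam ∘ₗ (TensorProduct.mk ℂ W₁ W₂).flip (plusMode M₂ z v n h w₂)

/-- The commutator of the two actions on an arbitrary functional is given by the iterates. -/
theorem tauProd_sub_tauProd (hz : z ≠ 0) (l m n : ℤ) :
    tauProd M₁ M₂ z u v lam w₁ w₂ l m 0 n 0 -
        (-1 : ℂ) ^ l • tauProd M₁ M₂ z v u lam w₁ w₂ l n 0 m 0 =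
      binExp 1 m (fun n j => tauMode M₁ M₂ z (A.Y u j v) n 0 lam (w₁ ⊗ₜ w₂)) n l := by
  have hsq : (-1 : ℂ) ^ l * (-1) ^ l = 1 := by
    rw [← zpow_add₀ (by norm_num), ← two_mul, zpow_mul]; norm_num
  let f₁ : W₁ →ₗ[ℂ] ℂ := lam ∘ₗ (TensorProduct.mk ℂ W₁ W₂).flip w₂
  let f₂ : W₂ →ₗ[ℂ] ℂ := lam ∘ₗ TensorProduct.mk ℂ W₁ W₂ w₁
  have hs := congrArg f₁ (starMode_borcherds M₁ z u v w₁ l m 0 n 0)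
  have hp := congrArg f₂ (plusMode_borcherds M₂ hz u v w₂ l m 0 n 0)
  simp only [binExp_zero] at hs hp
  have hQ₁ : Trunc fun n j => starMode M₁ z (A.Y u j v) n 0 w₁ :=
    A.trunc_of_truncation (f := fun x n => starMode M₁ z x n 0 w₁)
      (fun n => by rw [starMode_zero_vec]; rfl) u v
  have hQ₂ : Trunc fun n j => plusMode M₂ z (A.Y u j v) n 0 w₂ :=
    A.trunc_of_truncation (f := fun x n => plusMode M₂ z x n 0 w₂)
      (fun n => by rw [plusMode_zero_vec]; rfl) u v
  rw [map_sub, map_smul, map_binExp f₁ _ _ (trunc_starMode M₁ z u m w₁ _),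
    map_binExp f₁ _ _ (trunc_starMode M₁ z v n w₁ _), map_binExp f₁ _ _ hQ₁] at hs
  rw [map_sub, map_smul, map_binExp f₂ _ _ (trunc_plusMode M₂ z v n w₂ _),
    map_binExp f₂ _ _ (trunc_plusMode M₂ z u m w₂ _), map_binExp f₂ _ _ hQ₂] at hp
  simp only [f₁, f₂, LinearMap.comp_apply, LinearMap.flip_apply, TensorProduct.mk_apply] at hs hp
  simp only [tauProd_expand, tauMode_apply_tmul]
  have hQ₁' : Trunc fun n j => lam (starMode M₁ z (A.Y u j v) n 0 w₁ ⊗ₜ[ℂ] w₂) := hQ₁.map f₁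
  have hQ₂' : Trunc fun n j => lam (w₁ ⊗ₜ[ℂ] plusMode M₂ z (A.Y u j v) n 0 w₂) := hQ₂.map f₂
  rw [binExp_sub _ _ hQ₁' hQ₂', ← hs, ← hp]
  simp only [smul_eq_mul]
  -- The mixed terms of the two orders carry the same expansion of `(x₁ - x₂)^l` and differ by the
  -- factor `(-1)^l (-1)^l = 1`, so they cancel.
  linear_combination (binExp (-1) l (fun k h => lam (starMode M₁ z u m k w₁ ⊗ₜ
    plusMode M₂ z v n h w₂)) 0 0 - binExp (-1) l (fun k h => lam (w₁ ⊗ₜ plusMode M₂ z u m k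
      (plusMode M₂ z v n h w₂))) 0 0) * hsq

theorem Compatible.jacobiOn (hlam : Compatible M₁ M₂ z lam) (hz : z ≠ 0) (u v : V) :
    JacobiOn (fun a => A.Y a) (YQ M₁ M₂ z) u v lam := by
  refine jacobiOn_of_modes (hlam.1 u) (hlam.1 v) ?_ fun l m n => ?_
  · obtain ⟨N, hN⟩ := A.truncation u v
    exact ⟨N, fun n hn k => by
      rw [hN n hn, YQ_eq_tauMode, tauMode_zero_vec, LinearMap.zero_apply]⟩
  · simp only [YQ_eq_tauMode]
    refine TensorProduct.ext' fun w₁ w₂ => ?_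
    have hQ : Trunc fun n j => tauMode M₁ M₂ z (A.Y u j v) n 0 lam :=
      A.trunc_of_truncation (f := fun x n => tauMode M₁ M₂ z x n 0 lam)
        (fun n => by rw [tauMode_zero_vec]; rfl) u v
    have hR := map_binExp (LinearMap.applyₗ (w₁ ⊗ₜ[ℂ] w₂)) 1 m hQ n l
    simp only [LinearMap.applyₗ_apply_apply] at hR
    rw [LinearMap.sub_apply, LinearMap.smul_apply, ← hlam.tauProd_eq hz, ← hlam.tauProd_eq hz,
      tauProd_sub_tauProd hz]
    exact hR.symm

end Action

end QzTensor

end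

theorem theorem6p1 {V W₁ W₂ : Type*} [AddCommGroup V] [Module ℂ V]
    [AddCommGroup W₁] [Module ℂ W₁] [AddCommGroup W₂] [Module ℂ W₂]
    (A : QzTensor.VertexOperatorAlgebra V)
    (M₁ : QzTensor.VOAModule A W₁) (M₂ : QzTensor.VOAModule A W₂)
    (z : ℂ) (hz : z ≠ 0)
    (lam : Module.Dual ℂ (W₁ ⊗[ℂ] W₂)) (hlam : QzTensor.Compatible M₁ M₂ z lam) (u v : V) :
    QzTensor.JacobiOn (fun a => A.Y a) (QzTensor.YQ M₁ M₂ z) u v lam :=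
  hlam.jacobiOn hz u v
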